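/- Let $\mathcal O$ be a local principal ideal domain, not a field, with maximal ideal $\mathcal O s$ and finite residue field of odd characteristic. Let $\mathcal R=\mathcal O[t]=\mathcal O\oplus\mathcal O t$ with $t^2=s$, let $\ell>1$, and put $A=\mathcal R/\mathcal R t^{2\ell-1}$ and $R=\mathcal O/\mathcal O s^{\ell}\subset A$. Let $\pi\in A$ and $p=\pi^2\in R$ be the images of $t$ and $s$, put $\mathfrak r=A\pi$ and $\mathfrak m=Rp$, and let $*$ be the involution of $A$ that fixes $R$ and sends $\pi$ to $-\pi$. Let $V$ be a nonzero free $A$-module of finite rank and let $h:V\times V\to A$ be a nondegenerate skew hermitian form ($*$-linear in the first variable, linear in the second, $h(v,u)=-h(u,v)^*$), with unitary group $U=U(V,h)$. Let $f:V\times V\to R$, $f=\frac12(h+h^*)$, be the associated alternating form and let $H=R\times V$ be its Heisenberg group, with multiplication $(r,u)(s,v)=(r+s+f(u,v),u+v)$, on which $U$ acts by ${}^g(r,u)=(r,gu)$. Let $\lambda:R^+\to\mathbb C^\times$ be a primitive linear character (its kernel contains no nonzero ideal of $R$), and let $S:H\to GL(X)$ be a Schrödinger representation of type $\lambda$, that is,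 a finite dimensional irreducible complex representation on which $(R,0)$ acts through $\lambda$. A Weil representation of $U$ of type $\lambda$ is a representation $W:U\to GL(X)$ such that $W(g)S(k)W(g)^{-1}=S({}^gk)$ for all $g\in U$, $k\in H$. Let $\mathfrak n=\mathfrak r^{2\ell-2}$ be the minimal ideal of $A$ and let $\mathrm{Bot}=X(\mathfrak nV)$ be the space of fixed points of $(0,\mathfrak nV)$ in $X$. Put $\bar A=A/\mathfrak r^{2\ell-3}$, $\bar R=R/\mathfrak m^{\ell-1}$, $\bar V=V/\mathfrak r^{2\ell-3}V$, let $\bar h$ be the skew hermitian form on $\bar V$ over $\bar A$ induced by $h$, let $\bar f:\bar V\times\bar V\to\bar R$ be its associated alternating form and $\bar H=\bar R\times\bar V$ the corresponding Heisenberg group. Let $\bar U=U(\bar V,\bar h)$ and let $\Omega$ be the kernel of the natural homomorphism $U\to\bar U$, $g\mapsto\bar g$. Let $\bar\lambda$ be the linear character of $\bar R^+$ given by $\bar r\mapsto\lambda(-pr)$. Theorem. There is a Weil representation $W$ of $U$ of type $\lambda$ such that $\Omega$ acts trivially on $\mathrm{Bot}$ through $W$. Moreover, $\mathrm{Bot}$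 is $W(U)$-stable, there is exactly one representation $\bar W:\bar U\to GL(\mathrm{Bot})$ with $\bar W(\bar g)=W(g)|_{\mathrm{Bot}}$ for all $g\in U$, and $\bar W$ is a Weil representation of type $\bar\lambda$: $\bar\lambda$ is primitive, there is a Schrödinger representation $\bar S:\bar H\to GL(\mathrm{Bot})$ of type $\bar\lambda$ satisfying $\bar S(-\bar r,\bar v)=S(pr,\pi v)|_{\mathrm{Bot}}$ for $r\in R$, $v\in V$, and $\bar W(\bar g)\bar S(k)\bar W(\bar g)^{-1}=\bar S({}^{\bar g}k)$ for all $\bar g\in\bar U$, $k\in\bar H$. -/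

import Mathlib

open QuadraticAlgebra

noncomputable section

namespace RamWeil

/-! ### Forms, unitary groups and their reduction modulo an ideal -/

section Forms

variable {A : Type*} [CommRing A] {σ : A →+* A} {V : Type*} [AddCommGroup V] [Module A V]

/-- A form that is `σ`-linear in the first variable and linear in the second is a nondegenerate
skew hermitian form if `h(v,u) = -h(u,v)^σ` and `V → Hom_A(V,A)`, `u ↦ h(u,-)`, is injective. -/
structure IsNondegSkewHermitian (h : V →ₛₗ[σ] V →ₗ[A] A) : Prop where
  skew : ∀ u v, h v u = -σ (h u v)
  nondeg : Function.Injective h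

/-- The unitary group `U(V,h)`. -/
def unitaryGroup (h : V →ₛₗ[σ] V →ₗ[A] A) : Subgroup (V ≃ₗ[A] V) where
  carrier := {g | ∀ u v, h (g u) (g v) = h u v}
  one_mem' := fun _ _ => rfl
  mul_mem' := fun {a b} ha hb u v => by
    rw [LinearEquiv.mul_apply, LinearEquiv.mul_apply, ha, hb]
  inv_mem' := fun {a} ha u v => by
    have := ha (a⁻¹ u) (a⁻¹ v)
    rw [← LinearEquiv.mul_apply, ← LinearEquiv.mul_apply, mul_inv_cancel] at this
    exact this.symm

/-- The biadditive form `(u,v) ↦ re (h(u,v))` attached to `h` and an additive map `re`. -/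
def realPart {R : Type*} [CommRing R] (re : A →+ R) (h : V →ₛₗ[σ] V →ₗ[A] A) : V →+ V →+ R :=
  AddMonoidHom.mk' (fun u => re.comp (h u).toAddMonoidHom) (fun u v => by ext w; simp)

variable (I : Ideal A)

/-- The reduction `V/IV` of `V` modulo the ideal `I`, a module over `A/I`. -/
abbrev RedMod (V : Type*) [AddCommGroup V] [Module A V] : Type _ := V ⧸ (I • (⊤ : Submodule A V))

/-- The canonical projection `V → V/IV`. -/
abbrev redVec (v : V) : RedMod I V := Submodule.Quotient.mk v

theorem form_mem_left (h : V →ₛₗ[σ] V →ₗ[A] A) (hI : I ≤ I.comap σ) {u : V}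
    (hu : u ∈ I • (⊤ : Submodule A V)) (v : V) : h u v ∈ I := by
  induction hu using Submodule.smul_induction_on' with
  | smul a ha w _ =>
    rw [map_smulₛₗ, LinearMap.smul_apply]
    exact I.mul_mem_right _ (hI ha)
  | add x _ y _ hx hy =>
    rw [map_add, LinearMap.add_apply]
    exact I.add_mem hx hy

theorem form_mem_right (h : V →ₛₗ[σ] V →ₗ[A] A) (u : V) {v : V}
    (hv : v ∈ I • (⊤ : Submodule A V)) : h u v ∈ I := by
  induction hv using Submodule.smul_induction_on' with
  | smul a ha w _ =>
    rw [map_smul]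
    exact I.mul_mem_right _ ha
  | add x _ y _ hx hy =>
    rw [map_add]
    exact I.add_mem hx hy

/-- The function `(ū,v̄) ↦ h(u,v) + I` on `V/IV`. -/
def redFormFun (h : V →ₛₗ[σ] V →ₗ[A] A) (hI : I ≤ I.comap σ) (x y : RedMod I V) : A ⧸ I :=
  Quotient.liftOn₂' x y (fun u v => Ideal.Quotient.mk I (h u v)) (fun u v u' v' huu hvv => by
    have h1 := form_mem_left I h hI ((Submodule.quotientRel_def _).1 huu) v
    have h2 := form_mem_right I h u' ((Submodule.quotientRel_def _).1 hvv)
    refine Ideal.Quotient.eq.2 ?_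
    have h3 := I.add_mem h1 h2
    simpa using h3)

/-- The form `h̄` on `V/IV` over `A/I` induced by `h`: `h̄(ū,v̄) = h(u,v) + I`. -/
def redForm (h : V →ₛₗ[σ] V →ₗ[A] A) (hI : I ≤ I.comap σ) :
    RedMod I V →ₛₗ[Ideal.quotientMap I σ hI] RedMod I V →ₗ[A ⧸ I] A ⧸ I :=
  LinearMap.mk₂'ₛₗ (Ideal.quotientMap I σ hI) (RingHom.id (A ⧸ I)) (redFormFun I h hI)
    (fun x y z => by
      induction x using Submodule.Quotient.induction_on with | _ x =>
      induction y using Submodule.Quotient.induction_on with | _ y =>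
      induction z using Submodule.Quotient.induction_on with | _ z =>
      change Ideal.Quotient.mk I (h (x + y) z) = Ideal.Quotient.mk I (h x z) +
        Ideal.Quotient.mk I (h y z)
      simp)
    (fun c x y => by
      obtain ⟨c, rfl⟩ := Ideal.Quotient.mk_surjective c
      induction x using Submodule.Quotient.induction_on with | _ x =>
      induction y using Submodule.Quotient.induction_on with | _ y =>
      change Ideal.Quotient.mk I (h (c • x) y) = Ideal.Quotient.mk I (σ c) *
        Ideal.Quotient.mk I (h x y)
      simp)
    (fun x y z => by
      induction x using Submodule.Quotient.induction_on with | _ x =>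
      induction y using Submodule.Quotient.induction_on with | _ y =>
      induction z using Submodule.Quotient.induction_on with | _ z =>
      change Ideal.Quotient.mk I (h x (y + z)) = Ideal.Quotient.mk I (h x y) +
        Ideal.Quotient.mk I (h x z)
      simp)
    (fun c x y => by
      obtain ⟨c, rfl⟩ := Ideal.Quotient.mk_surjective c
      induction x using Submodule.Quotient.induction_on with | _ x =>
      induction y using Submodule.Quotient.induction_on with | _ y =>
      change Ideal.Quotient.mk I (h x (c • y)) = Ideal.Quotient.mk I c *
        Ideal.Quotient.mk I (h x y)
      simp)

theorem redForm_mk (h : V →ₛₗ[σ] V →ₗ[A] A) (hI : I ≤ I.comap σ) (u v : V) :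
    redForm I h hI (redVec I u) (redVec I v) = Ideal.Quotient.mk I (h u v) := rfl

/-- The `A/I`-linear endomorphism of `V/IV` induced by an `A`-linear endomorphism of `V`. -/
def redEnd (g : V →ₗ[A] V) : RedMod I V →ₗ[A ⧸ I] RedMod I V where
  toFun := Submodule.mapQ (I • ⊤) (I • ⊤) g (Submodule.smul_top_le_comap_smul_top I g)
  map_add' := map_add _
  map_smul' := fun c x => by
    obtain ⟨c, rfl⟩ := Ideal.Quotient.mk_surjective c
    exact map_smul (Submodule.mapQ (I • ⊤) (I • ⊤) g
      (Submodule.smul_top_le_comap_smul_top I g)) c x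

theorem redEnd_mk (g : V →ₗ[A] V) (v : V) : redEnd I g (redVec I v) = redVec I (g v) := rfl

/-- The `A/I`-linear automorphism of `V/IV` induced by an `A`-linear automorphism of `V`. -/
def redEquiv (g : V ≃ₗ[A] V) : RedMod I V ≃ₗ[A ⧸ I] RedMod I V :=
  LinearEquiv.ofLinearMap (redEnd I g.toLinearMap) (redEnd I g.symm.toLinearMap)
    (LinearMap.ext fun x => by
      induction x using Submodule.Quotient.induction_on with | _ x =>
      change redVec I (g (g.symm x)) = redVec I x
      simp)
    (LinearMap.ext fun x => by
      induction x using Submodule.Quotient.induction_on with | _ x =>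
      change redVec I (g.symm (g x)) = redVec I x
      simp)

/-- The natural homomorphism `U(V,h) → U(V/IV,h̄)`, `g ↦ ḡ` with `ḡ v̄ = \overline{g v}`. -/
def redU (h : V →ₛₗ[σ] V →ₗ[A] A) (hI : I ≤ I.comap σ) :
    unitaryGroup h →* unitaryGroup (redForm I h hI) where
  toFun g := ⟨redEquiv I g.1, fun x y => by
    induction x using Submodule.Quotient.induction_on with | _ x =>
    induction y using Submodule.Quotient.induction_on with | _ y =>
    change Ideal.Quotient.mk I (h (g.1 x) (g.1 y)) = Ideal.Quotient.mk I (h x y)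
    rw [g.2 x y]⟩
  map_one' := Subtype.ext <| LinearEquiv.ext fun x => by
    induction x using Submodule.Quotient.induction_on with | _ x => rfl
  map_mul' := fun g g' => Subtype.ext <| LinearEquiv.ext fun x => by
    induction x using Submodule.Quotient.induction_on with | _ x => rfl

end Forms

/-! ### Heisenberg groups, Schrödinger and Weil representations -/

/-- The Heisenberg group `R × V` of a biadditive form `f : V × V → R`. -/
@[ext]
structure Heis {R V : Type*} [CommRing R] [AddCommGroup V] (f : V →+ V →+ R) where
  /-- the central coordinate -/
  z : R
  /-- the vector coordinate -/
  v : V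

namespace Heis

variable {R V : Type*} [CommRing R] [AddCommGroup V] {f : V →+ V →+ R}

instance : Mul (Heis f) := ⟨fun a b => ⟨a.z + b.z + f a.v b.v, a.v + b.v⟩⟩

instance : One (Heis f) := ⟨⟨0, 0⟩⟩

instance : Inv (Heis f) := ⟨fun a => ⟨-a.z + f a.v a.v, -a.v⟩⟩

theorem mul_def (a b : Heis f) : a * b = ⟨a.z + b.z + f a.v b.v, a.v + b.v⟩ := rfl

theorem one_def : (1 : Heis f) = ⟨0, 0⟩ := rfl

theorem inv_def (a : Heis f) : a⁻¹ = ⟨-a.z + f a.v a.v, -a.v⟩ := rfl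

instance : Group (Heis f) :=
  Group.ofLeftAxioms
    (fun a b c => by ext <;> simp [mul_def] <;> abel)
    (fun a => by ext <;> simp [mul_def, one_def])
    (fun a => by ext <;> simp [mul_def, one_def, inv_def])

end Heis

section Representations

variable {R V X : Type*} [CommRing R] [AddCommGroup V] {f : V →+ V →+ R}
  [AddCommGroup X] [Module ℂ X]

/-- `S` is a Schrödinger representation of type `lam`: `lam` is a primitive linear character of
`R⁺`, `S` is irreducible, and the central subgroup `(R,0)` acts through `lam`. -/
structure IsSchrodinger (lam : AddChar R ℂ) (S : Representation ℂ (Heis f) X) : Prop where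
  primitive : lam.IsPrimitive
  irreducible : S.IsIrreducible
  central : ∀ (r : R) (x : X), S ⟨r, 0⟩ x = lam r • x

/-- The space `X(M)` of fixed points of `(0,M)` in `X`. -/
def fixedPts (S : Representation ℂ (Heis f) X) (M : Set V) : Submodule ℂ X where
  carrier := {x | ∀ u ∈ M, S ⟨0, u⟩ x = x}
  add_mem' := fun ha hb u hu => by rw [map_add, ha u hu, hb u hu]
  zero_mem' := fun _ _ => map_zero _
  smul_mem' := fun c x hx u hu => by rw [map_smul, hx u hu]

/-- For a unitary group whose elements act on the Heisenberg group of `f = re ∘ h` by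
`ᵍ(r,u) = (r,gu)`, the representation `W` is a Weil representation relative to `S` if
`W(g) S(k) W(g)⁻¹ = S(ᵍk)` for all `g` and `k`. -/
def IsWeil {A : Type*} [CommRing A] [Module A V] {σ : A →+* A} {h : V →ₛₗ[σ] V →ₗ[A] A}
    {re : A →+ R} (S : Representation ℂ (Heis (realPart re h)) X)
    (W : Representation ℂ (unitaryGroup h) X) : Prop :=
  ∀ (g : unitaryGroup h) (r : R) (u : V),
    W g ∘ₗ S ⟨r, u⟩ ∘ₗ W g⁻¹ = S ⟨r, g.1 u⟩

end Representations

/-! ### The ramified quadratic extension -/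

section Rings

variable {O : Type*} [CommRing O] (s : O) (l : ℕ)

/-- `R = O/(s^l)`. -/
def RingR : Type _ := O ⧸ Ideal.span {s ^ l}

instance : CommRing (RingR s l) := inferInstanceAs (CommRing (O ⧸ Ideal.span {s ^ l}))

/-- The canonical projection `O → R`. -/
def toR : O →+* RingR s l := Ideal.Quotient.mk (Ideal.span {s ^ l})

theorem toR_surjective : Function.Surjective (toR s l) := Ideal.Quotient.mk_surjective

theorem toR_eq_zero_iff {x : O} : toR s l x = 0 ↔ x ∈ Ideal.span {s ^ l} :=
  Ideal.Quotient.eq_zero_iff_mem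

/-- `p`, the image of `s` in `R`. -/
def p : RingR s l := toR s l s

/-- The maximal ideal `m = Rp`. -/
def idealM : Ideal (RingR s l) := Ideal.span {p s l}

/-- `A = O[t]/(t^(2l-1))`, where `O[t] = O ⊕ Ot` and `t² = s` (`t` is called `ω` in Mathlib). -/
def RingA : Type _ :=
  QuadraticAlgebra O s 0 ⧸ Ideal.span {(ω : QuadraticAlgebra O s 0) ^ (2 * l - 1)}

instance : CommRing (RingA s l) := inferInstanceAs
  (CommRing (QuadraticAlgebra O s 0 ⧸ Ideal.span {(ω : QuadraticAlgebra O s 0) ^ (2 * l - 1)}))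

/-- The canonical projection `O[t] → A`. -/
def toA : QuadraticAlgebra O s 0 →+* RingA s l :=
  Ideal.Quotient.mk (Ideal.span {(ω : QuadraticAlgebra O s 0) ^ (2 * l - 1)})

theorem toA_surjective : Function.Surjective (toA s l) := Ideal.Quotient.mk_surjective

theorem toA_eq_zero_iff {x : QuadraticAlgebra O s 0} :
    toA s l x = 0 ↔ x ∈ Ideal.span {(ω : QuadraticAlgebra O s 0) ^ (2 * l - 1)} :=
  Ideal.Quotient.eq_zero_iff_mem

/-- `π`, the image of `t` in `A`. -/
def pi : RingA s l := toA s l ω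

/-- The maximal ideal `r = Aπ`. -/
def idealR : Ideal (RingA s l) := Ideal.span {pi s l}

theorem star_omega : starRingEnd (QuadraticAlgebra O s 0) ω = -ω := by
  rw [starRingEnd_apply]
  ext <;> simp

/-- The involution of `A` induced by `x + yt ↦ x - yt`. -/
def conj : RingA s l →+* RingA s l :=
  Ideal.quotientMap _ (starRingEnd (QuadraticAlgebra O s 0)) (by
    rw [Ideal.span_singleton_le_iff_mem, Ideal.mem_comap, map_pow, star_omega, neg_pow]
    exact Ideal.mul_mem_left _ _ (Ideal.mem_span_singleton_self _))

theorem conj_mk (x : QuadraticAlgebra O s 0) :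
    conj s l (toA s l x) = toA s l (star x) := rfl

theorem conj_pi : conj s l (pi s l) = -pi s l := by
  rw [pi, conj_mk, ← starRingEnd_apply, star_omega, map_neg]

theorem omega_pow_odd (k : ℕ) :
    (ω : QuadraticAlgebra O s 0) ^ (2 * k + 1) = ⟨0, s ^ k⟩ := by
  induction k with
  | zero => ext <;> simp
  | succ k ih =>
    rw [show 2 * (k + 1) + 1 = (2 * k + 1) + 2 by ring, pow_add, ih]
    ext <;> simp [pow_succ]

theorem re_mem_span_of_mem (k j : ℕ) (hkj : j = 0 ∨ k = 2 * (j - 1) + 1) {x : QuadraticAlgebra O s 0}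
    (hx : x ∈ Ideal.span {(ω : QuadraticAlgebra O s 0) ^ k}) : x.re ∈ Ideal.span {s ^ j} := by
  rcases hkj with rfl | rfl
  · simp
  · rcases j with _ | j
    · simp
    obtain ⟨y, rfl⟩ := Ideal.mem_span_singleton.1 hx
    rw [Nat.add_sub_cancel, omega_pow_odd, Ideal.mem_span_singleton]
    refine ⟨y.im, ?_⟩
    simp [pow_succ]
    ring

/-- The additive map `A → R`, `a + bπ ↦ a` (`a, b ∈ R`). -/
def reA : RingA s l →+ RingR s l :=
  QuotientAddGroup.map (Submodule.toAddSubgroup _) (Submodule.toAddSubgroup _)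
    (AddMonoidHom.mk' (fun x : QuadraticAlgebra O s 0 => x.re) (fun _ _ => rfl))
    (fun x hx => re_mem_span_of_mem s (2 * l - 1) l (by omega) hx)

theorem reA_mk (x : QuadraticAlgebra O s 0) :
    reA s l (toA s l x) = toR s l x.re := rfl

/-! The reduced rings `Ā = A/r^(2l-3)` and `R̄ = R/m^(l-1)`. -/

/-- The ideal `r^(2l-3)`. -/
def idealJ : Ideal (RingA s l) := idealR s l ^ (2 * l - 3)

/-- `Ā = A/r^(2l-3)`. -/
abbrev RingAbar : Type _ := RingA s l ⧸ idealJ s l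

/-- `R̄ = R/m^(l-1)`. -/
abbrev RingRbar : Type _ := RingR s l ⧸ idealM s l ^ (l - 1)

theorem idealJ_le : idealJ s l ≤ (idealJ s l).comap (conj s l) := by
  rw [idealJ, idealR, Ideal.span_singleton_pow, Ideal.span_singleton_le_iff_mem, Ideal.mem_comap,
    map_pow, conj_pi, neg_pow]
  exact Ideal.mul_mem_left _ _ (Ideal.mem_span_singleton_self _)

/-- The additive map `Ā → R̄` induced by `reA`. -/
def reAbar : RingAbar s l →+ RingRbar s l :=
  QuotientAddGroup.map (Submodule.toAddSubgroup _) (Submodule.toAddSubgroup _) (reA s l)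
    (fun x hx => by
      change reA s l x ∈ idealM s l ^ (l - 1)
      change x ∈ idealJ s l at hx
      rw [idealJ, idealR, Ideal.span_singleton_pow] at hx
      obtain ⟨y, rfl⟩ := Ideal.mem_span_singleton.1 hx
      obtain ⟨y, rfl⟩ := toA_surjective s l y
      rw [pi, ← map_pow, ← map_mul, reA_mk]
      have hy := re_mem_span_of_mem s (2 * l - 3) (l - 1) (by omega)
        (Ideal.mul_mem_right y _ (Ideal.mem_span_singleton_self
          ((ω : QuadraticAlgebra O s 0) ^ (2 * l - 3))))
      obtain ⟨z, hz⟩ := Ideal.mem_span_singleton.1 hy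
      rw [hz, map_mul, map_pow, idealM, Ideal.span_singleton_pow]
      exact Ideal.mul_mem_right _ _ (Ideal.mem_span_singleton_self _))

theorem reAbar_mk (x : RingA s l) :
    reAbar s l (Ideal.Quotient.mk _ x) = Ideal.Quotient.mk _ (reA s l x) := rfl

theorem p_mul_eq_zero {x : RingR s l} (hx : x ∈ idealM s l ^ (l - 1)) : p s l * x = 0 := by
  have h0 : p s l ^ l = 0 := by
    rw [p, ← map_pow]
    exact (toR_eq_zero_iff s l).2 (Ideal.mem_span_singleton_self _)
  rw [idealM, Ideal.span_singleton_pow] at hx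
  obtain ⟨y, rfl⟩ := Ideal.mem_span_singleton.1 hx
  rw [← mul_assoc, ← pow_succ']
  rcases l with _ | l
  · rw [pow_zero] at h0
    rw [← one_mul (_ * y), h0, zero_mul]
  · rw [Nat.add_sub_cancel, h0, zero_mul]

/-- The additive map `R̄ → R`, `r̄ ↦ -pr`. -/
def negMulP : RingRbar s l →+ RingR s l :=
  QuotientAddGroup.lift (Submodule.toAddSubgroup _) (AddMonoidHom.mulLeft (-p s l))
    (fun x hx => by simpa using p_mul_eq_zero s l hx)

theorem negMulP_mk (r : RingR s l) : negMulP s l (Ideal.Quotient.mk _ r) = -(p s l * r) := by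
  rw [← neg_mul]; rfl

/-- The linear character `λ̄` of `R̄⁺`, `λ̄(r̄) = λ(-pr)`. -/
def lamBar (lam : AddChar (RingR s l) ℂ) : AddChar (RingRbar s l) ℂ :=
  lam.compAddMonoidHom (negMulP s l)

end Rings

/-! ### The objects of the theorem -/

section Objects

variable {O : Type*} [CommRing O] {s : O} {l : ℕ} {V : Type*} [AddCommGroup V]
  [Module (RingA s l) V] (h : V →ₛₗ[conj s l] V →ₗ[RingA s l] RingA s l)

/-- The alternating form `f` associated to `h`: `h(u,v) = f(u,v) + k(u,v)π`. -/
abbrev altForm : V →+ V →+ RingR s l := realPart (reA s l) h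

variable (V) in
/-- `V̄ = V/r^(2l-3)V`. -/
abbrev Vbar : Type _ := RedMod (idealJ s l) V

/-- The form `h̄` on `V̄`. -/
abbrev hbar : Vbar (s := s) (l := l) V
    →ₛₗ[Ideal.quotientMap (idealJ s l) (conj s l) (idealJ_le s l)]
    Vbar (s := s) (l := l) V →ₗ[RingAbar s l] RingAbar s l := redForm (idealJ s l) h (idealJ_le s l)

/-- The alternating form `f̄` associated to `h̄`. -/
abbrev altFormBar : Vbar (s := s) (l := l) V →+ Vbar (s := s) (l := l) V →+ RingRbar s l :=
  realPart (reAbar s l) (hbar h)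

theorem altFormBar_mk (u v : V) : altFormBar h (redVec _ u) (redVec _ v) =
    Ideal.Quotient.mk _ (altForm h u v) := rfl

/-- The natural homomorphism `U → Ū`. -/
abbrev toUbar : unitaryGroup h →* unitaryGroup (hbar h) := redU (idealJ s l) h (idealJ_le s l)

/-- The congruence subgroup `Ω`, the kernel of `U → Ū`. -/
def Omega : Subgroup (unitaryGroup h) := (toUbar h).ker

theorem mem_Omega (g : unitaryGroup h) :
    g ∈ Omega h ↔ ∀ v : V, g.1 v - v ∈ idealJ s l • (⊤ : Submodule (RingA s l) V) := by
  rw [Omega, MonoidHom.mem_ker]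
  constructor
  · intro hg v
    have := congrArg (fun k => k.1 (redVec (idealJ s l) v)) hg
    exact (Submodule.Quotient.eq _).1 this
  · intro hg
    refine Subtype.ext (LinearEquiv.ext fun x => ?_)
    induction x using Submodule.Quotient.induction_on with | _ x =>
    exact (Submodule.Quotient.eq _).2 (hg x)

variable {h}
variable {X : Type*} [AddCommGroup X] [Module ℂ X]

/-- `Bot = X(nV)`, where `n = r^(2l-2)` is the minimal ideal of `A`. -/
def Bot (S : Representation ℂ (Heis (altForm h)) X) : Submodule ℂ X :=
  fixedPts S ((idealR s l ^ (2 * l - 2) • (⊤ : Submodule (RingA s l) V) : Submodule _ V) : Set V)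

/-- `Wbar` is a representation of `Ū` afforded by `Bot` through `W`: `Bot` is stable under `W`,
and `g ∈ U` acts on `Bot` through `W` as `ḡ` does through `Wbar`. -/
def IsAffordedByBot (S : Representation ℂ (Heis (altForm h)) X)
    (W : Representation ℂ (unitaryGroup h) X)
    (Wbar : Representation ℂ (unitaryGroup (hbar h)) (Bot S)) : Prop :=
  ∀ (g : unitaryGroup h) (x : Bot S), W g (x : X) = (Wbar (toUbar h g) x : X)

end Objects

end RamWeil

end

/-! Write $T_v$ for the operator by which $(0,v)$ acts (`trans`). By Schur's lemma the intertwiners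
attached to $g\in U$ differ by scalars, and averaging over $V$ produces an invertible one
(`exists_intertwiner`). The operator $P=(\dim X)^{-1}\sum_v T_v$ is an involution that lifts
$v\mapsto -v$ and has trace $1$, so the even part of $X$ has exactly one dimension more than the odd
part. Scaling an intertwiner by $c$ therefore multiplies the quotient of its determinants on the two
parts by $c$, and exactly one intertwiner has quotient $1$. These canonical operators multiply, and
they make up $W$ (`exists_canonicalRep`).

Let $g\in\Omega$. The orthogonal of $\mathfrak nV$ is $\mathfrak rV$, and Bot is irreducible under
the $T_u$ with $u\in\mathfrak rV$ (`Bot_le_of_stable`). As $g$ moves $\pi v$ only by an element of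
$\mathfrak nV$, $W(g)$ is a scalar $c$ on Bot. To see that $c=1$, split $X$ into isotypic parts
under $(0,\mathfrak nV)$: Bot belongs to the trivial character, and $P$ exchanges the parts of
$\psi$ and $-\psi$. Weighting the parts by signs odd in $\psi$ gives an operator that commutes with
$W(g)$ and exchanges even and odd vectors in the complement of Bot. The two determinants thus agree
on that complement, hence also on Bot. There too the even part is larger by one dimension, so
$c^{m+1}=c^m$ (`eq_one_of_isCanonical`).

Newton's method shows that $U\to\bar U$ is onto (`redU_surjective`), so the action on Bot descends,
in only one way. The identity $f(\pi u,\pi v)=-p\,f(u,v)$ turns $\bar v\mapsto T_{\pi v}$ on Bot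
into a Schrödinger representation of type $\bar\lambda$ (`exists_Sbar`). -/

noncomputable section

namespace RamWeil

/-! ### Idempotents and determinants -/

section Idempotents

variable {X : Type*} [AddCommGroup X] [Module ℂ X]

/-- `B q + (1 - q)`: the operator that agrees with `B` on the range of an idempotent `q` and with
the identity on its kernel. -/
def partialOp (B q : Module.End ℂ X) : Module.End ℂ X := B * q + (1 - q)

theorem partialOp_mul {B C q : Module.End ℂ X} (hq : IsIdempotentElem q) (hC : Commute C q) :
    partialOp B q * partialOp C q = partialOp (B * C) q := by
  have h1 : q * q = q := hq
  have h2 : C * q = q * C := hC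
  have h3 : q * (C * q) = C * q := by rw [h2, ← mul_assoc, h1]
  have e1 : B * q * (C * q) = B * C * q := by rw [mul_assoc, h3, mul_assoc]
  have e2 : B * q * (1 - q) = 0 := by rw [mul_assoc, mul_sub, mul_one, h1, sub_self, mul_zero]
  have e3 : (1 - q) * (C * q) = 0 := by rw [sub_mul, one_mul, h3, sub_self]
  have e4 : (1 - q) * (1 - q) = 1 - q := by
    rw [mul_sub, mul_one, sub_mul, one_mul, h1, sub_self, sub_zero]
  simp only [partialOp, add_mul, mul_add, e1, e2, e3, e4, zero_add, add_zero]

theorem partialOp_one (q : Module.End ℂ X) : partialOp 1 q = 1 := by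
  simp [partialOp]

/-- The partial operators along orthogonal idempotents multiply to that along the sum. -/
theorem partialOp_mul_of_orthogonal {B q r : Module.End ℂ X} (hqr : q * r = 0)
    (hB : Commute B r) : partialOp B q * partialOp B r = partialOp B (q + r) := by
  have h2 : B * r = r * B := hB
  have e1 : q * (B * r) = 0 := by rw [h2, ← mul_assoc, hqr, zero_mul]
  simp only [partialOp, add_mul, mul_add, sub_mul, mul_sub, mul_assoc, e1, hqr, one_mul, mul_one,
    mul_zero]
  abel

theorem partialOp_conj {B N q r : Module.End ℂ X} (hN : N * N = 1) (hB : Commute N B)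
    (hq : N * q * N = r) : N * partialOp B q * N = partialOp B r := by
  have h2 : N * B = B * N := hB
  rw [← hq, partialOp, partialOp, mul_add, add_mul, mul_sub, sub_mul, mul_one, hN, ← mul_assoc, h2]
  simp only [mul_assoc]

theorem det_partialOp_conj {B N q r : Module.End ℂ X} (hN : N * N = 1) (hB : Commute N B)
    (hq : N * q * N = r) : LinearMap.det (partialOp B q) = LinearMap.det (partialOp B r) := by
  rw [← partialOp_conj hN hB hq, map_mul, map_mul, mul_comm, ← mul_assoc, ← map_mul, hN, map_one,
    one_mul]

variable [FiniteDimensional ℂ X]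

/-- Along $X=\operatorname{range} q\oplus\ker q$ the operator is $c\oplus 1$. Recording that the
exponent equals the trace of $q$ lets exponents be compared by computing traces. -/
theorem exists_rank_det_partialOp_smul {q : Module.End ℂ X} (hq : IsIdempotentElem q) :
    ∃ k : ℕ, LinearMap.trace ℂ X q = k ∧
      ∀ c : ℂ, LinearMap.det (partialOp (c • 1) q) = c ^ k := by
  have hp := LinearMap.IsIdempotentElem.isProj_range q hq
  refine ⟨_, hp.trace, fun c => ?_⟩
  let e := (LinearMap.range q).prodEquivOfIsCompl _ hp.isCompl
  have hqe : q = e.conj (LinearMap.id.prodMap 0) := hp.eq_conj_prod_map'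
  have h1 : (1 : Module.End ℂ X) = e.conj LinearMap.id := by rw [LinearEquiv.conj_id]; rfl
  have key : partialOp (c • 1) q = e.conj ((c • LinearMap.id).prodMap LinearMap.id) := by
    have h2 : partialOp (c • 1) q = c • q + (1 - q) := by rw [partialOp, smul_mul_assoc, one_mul]
    rw [h2, h1, congrArg₂ (fun a b => c • a + (e.conj LinearMap.id - b)) hqe hqe, ← map_smul,
      ← map_sub, ← map_add]
    congr 1
    ext x <;> simp
  rw [key, LinearEquiv.conj_apply, LinearMap.comp_assoc, LinearMap.det_conj, LinearMap.det_prodMap]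
  simp

theorem isUnit_partialOp {B q : Module.End ℂ X} (hq : IsIdempotentElem q) (hB : IsUnit B)
    (hc : Commute B q) : IsUnit (partialOp B q) := by
  obtain ⟨u, rfl⟩ := hB
  refine IsUnit.of_mul_eq_one (partialOp (↑u⁻¹ : Module.End ℂ X) q) ?_
  rw [partialOp_mul hq (Commute.units_inv_left hc), Units.mul_inv, partialOp_one]

end Idempotents

/-! ### Schrödinger representations of finite Heisenberg groups -/

section Schrodinger

variable {R V X : Type*} [CommRing R] [AddCommGroup V] {f : V →+ V →+ R}
  [AddCommGroup X] [Module ℂ X]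

/-- The operator by which `(0,v)` acts. -/
def trans (S : Representation ℂ (Heis f) X) (v : V) : Module.End ℂ X := S ⟨0, v⟩

/-- The operator that lifts `v ↦ -v`. -/
def parity [Fintype V] (S : Representation ℂ (Heis f) X) : Module.End ℂ X :=
  (Module.finrank ℂ X : ℂ)⁻¹ • ∑ v, trans S v

/-- An irreducible representation with central character `lam` of the Heisenberg group of an
alternating form `f` on a `2`-divisible group such that `lam ∘ f` is nondegenerate. -/
structure IsRegular (lam : AddChar R ℂ) (S : Representation ℂ (Heis f) X) : Prop where
  central : ∀ (r : R) (x : X), S ⟨r, 0⟩ x = lam r • x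
  irreducible : S.IsIrreducible
  alt : ∀ v, f v v = 0
  half : ∀ v : V, ∃ u, u + u = v
  nondeg : ∀ v, (∀ u, lam (f u v) = 1) → v = 0

theorem trans_zero (S : Representation ℂ (Heis f) X) : trans S 0 = 1 := map_one S

theorem apply_eq_smul_trans {lam : AddChar R ℂ} {S : Representation ℂ (Heis f) X}
    (hc : ∀ (r : R) (x : X), S ⟨r, 0⟩ x = lam r • x) (r : R) (v : V) :
    S ⟨r, v⟩ = lam r • trans S v := by
  have : (⟨r, v⟩ : Heis f) = ⟨r, 0⟩ * ⟨0, v⟩ := by ext <;> simp [Heis.mul_def]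
  rw [this, map_mul]
  ext x
  rw [Module.End.mul_apply, hc]
  rfl

namespace IsRegular

variable {lam : AddChar R ℂ} {S : Representation ℂ (Heis f) X} (hS : IsRegular lam S)
include hS

theorem apply_eq (r : R) (v : V) : S ⟨r, v⟩ = lam r • trans S v :=
  apply_eq_smul_trans hS.central r v

theorem trans_mul (u v : V) : trans S u * trans S v = lam (f u v) • trans S (u + v) := by
  rw [← hS.apply_eq, trans, trans, ← map_mul]
  congr 1
  ext <;> simp [Heis.mul_def]

theorem skew (u v : V) : f u v = -f v u := by
  have := hS.alt (u + v)
  simp only [map_add, AddMonoidHom.add_apply, hS.alt, zero_add, add_zero] at this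
  exact eq_neg_of_add_eq_zero_right this

theorem trans_mul_neg (v : V) : trans S v * trans S (-v) = 1 := by
  rw [hS.trans_mul, map_neg, hS.alt, neg_zero, AddChar.map_zero_eq_one, one_smul, add_neg_cancel,
    trans_zero]

theorem trans_neg_mul (v : V) : trans S (-v) * trans S v = 1 := by
  simpa using hS.trans_mul_neg (-v)

theorem trans_conj (u v : V) :
    trans S u * trans S v * trans S (-u) = lam (f u v + f u v) • trans S v := by
  rw [hS.trans_mul, smul_mul_assoc, hS.trans_mul, smul_smul, ← AddChar.map_add_eq_mul]
  congr 2
  · rw [map_neg, map_add, AddMonoidHom.add_apply, hS.alt, zero_add, hS.skew v u, neg_neg]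
  · abel

theorem trans_comm (u v : V) :
    trans S u * trans S v = lam (f u v + f u v) • (trans S v * trans S u) := by
  rw [← smul_mul_assoc, ← hS.trans_conj, mul_assoc _ (trans S (-u)), hS.trans_neg_mul, mul_one]

theorem nontrivial : Nontrivial X := by
  have := hS.irreducible
  by_contra hX
  rw [not_nontrivial_iff_subsingleton] at hX
  exact bot_ne_top (α := Subrepresentation S)
    (Subrepresentation.toSubmodule_injective (Subsingleton.elim _ _))

theorem eq_bot_or_top (Z : Submodule ℂ X) (hZ : ∀ v, ∀ z ∈ Z, trans S v z ∈ Z) :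
    Z = ⊥ ∨ Z = ⊤ := by
  have := hS.irreducible
  have h1 := eq_bot_or_eq_top (⟨Z, fun k z hz => by
    obtain ⟨r, v⟩ := k
    rw [hS.apply_eq]
    exact Z.smul_mem _ (hZ v z hz)⟩ : Subrepresentation S)
  exact h1.imp (congrArg Subrepresentation.toSubmodule) (congrArg Subrepresentation.toSubmodule)

theorem exists_ne_one {v : V} (hv : v ≠ 0) : ∃ u, lam (f u v + f u v) ≠ 1 := by
  by_contra! h
  refine hv (hS.nondeg v fun u => ?_)
  obtain ⟨w, rfl⟩ := hS.half u
  rw [map_add, AddMonoidHom.add_apply, h]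

/-- Conjugation by a suitable $T_u$ multiplies $T_v$ by a scalar other than $1$ but preserves the
trace. -/
theorem trace_trans_of_ne {v : V} (hv : v ≠ 0) : LinearMap.trace ℂ X (trans S v) = 0 := by
  obtain ⟨u, hu⟩ := hS.exists_ne_one hv
  have h1 := congrArg (LinearMap.trace ℂ X) (hS.trans_conj u v)
  rw [LinearMap.trace_mul_comm, ← mul_assoc, hS.trans_neg_mul, one_mul, map_smul, smul_eq_mul] at h1
  by_contra h0
  exact hu (mul_right_cancel₀ h0 (by rw [one_mul, ← h1]))

theorem double_eq_zero [Finite V] {v : V} (hv : v + v = 0) : v = 0 := by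
  have h1 : Function.Surjective (fun u : V => u + u) := hS.half
  exact Finite.injective_iff_surjective.2 h1 (by simpa using hv)

variable [FiniteDimensional ℂ X]

theorem finrank_ne_zero : (Module.finrank ℂ X : ℂ) ≠ 0 := by
  have := hS.nontrivial
  exact_mod_cast (Module.finrank_pos (R := ℂ) (M := X)).ne'

theorem trace_trans [DecidableEq V] (v : V) :
    LinearMap.trace ℂ X (trans S v) = if v = 0 then (Module.finrank ℂ X : ℂ) else 0 := by
  split_ifs with hv
  · rw [hv, trans_zero, LinearMap.trace_one]
  · exact hS.trace_trans_of_ne hv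

/-- Linear independence of the $T_v$: multiplying by $T_{-u}$ and taking the trace isolates the
coefficient at $u$. -/
theorem coeff_eq_zero [Fintype V] {c : V → ℂ} (hc : ∑ v, c v • trans S v = 0) (u : V) :
    c u = 0 := by
  classical
  have h1 := congrArg (fun B => LinearMap.trace ℂ X (B * trans S (-u))) hc
  simp only [Finset.sum_mul, smul_mul_assoc, hS.trans_mul, map_sum, map_smul, hS.trace_trans,
    zero_mul, map_zero, ← sub_eq_add_neg, sub_eq_zero, smul_eq_mul, mul_ite, mul_zero,
    Finset.sum_ite_eq', Finset.mem_univ, if_true] at h1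
  simpa [hS.alt, hS.finrank_ne_zero] using h1

theorem exists_eq_smul_one {B : Module.End ℂ X} (hB : ∀ v, Commute B (trans S v)) :
    ∃ c : ℂ, B = c • 1 := by
  have := hS.nontrivial
  obtain ⟨c, hc⟩ := Module.End.exists_eigenvalue B
  refine ⟨c, ?_⟩
  have h1 := hS.eq_bot_or_top (Module.End.eigenspace B c) fun v z hz => by
    rw [Module.End.mem_eigenspace_iff] at hz ⊢
    rw [← Module.End.mul_apply, (hB v).eq, Module.End.mul_apply, hz, map_smul]
  ext x
  have h2 : x ∈ Module.End.eigenspace B c := by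
    rw [h1.resolve_left hc]; trivial
  exact Module.End.mem_eigenspace_iff.1 h2

/-! ### Averaging over $V$: the dimension formula and the existence of intertwiners. -/

section Average

variable [Fintype V]

omit [FiniteDimensional ℂ X] in
theorem average_intertwines (g : V ≃+ V) (hg : ∀ u v, f (g u) (g v) = f u v)
    (B : Module.End ℂ X) (u : V) :
    trans S (g u) * (∑ v, trans S (g v) * B * trans S (-v)) =
      (∑ v, trans S (g v) * B * trans S (-v)) * trans S u := by
  have h1 : trans S (g u) * (∑ v, trans S (g v) * B * trans S (-v)) * trans S (-u) =
      ∑ v, trans S (g v) * B * trans S (-v) := by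
    rw [Finset.mul_sum, Finset.sum_mul]
    refine Fintype.sum_equiv (Equiv.addLeft u) _ _ fun v => ?_
    have h2 : trans S (g u) * (trans S (g v) * B * trans S (-v)) * trans S (-u) =
      (trans S (g u) * trans S (g v)) * B * (trans S (-v) * trans S (-u)) := by
      simp only [mul_assoc]
    rw [h2, hS.trans_mul, hS.trans_mul, hg, smul_mul_assoc, smul_mul_smul_comm,
      ← AddChar.map_add_eq_mul, ← map_add, Equiv.coe_addLeft, neg_add_rev]
    rw [map_neg, map_neg, AddMonoidHom.neg_apply, neg_neg, hS.skew v u, add_neg_cancel,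
      AddChar.map_zero_eq_one, one_smul]
  rw [← h1, mul_assoc _ (trans S (-u)), hS.trans_neg_mul, mul_one, h1]

/-- Schur orthogonality. The average of a rank one operator is a scalar, determined by its trace;
read off in a basis and summed over the diagonal matrix coefficients, this evaluates
$\sum_v\operatorname{tr}T_{-v}\operatorname{tr}T_v$, to which only $v=0$ contributes. The formula is
what normalises the parity operator. -/
theorem card_eq : (Fintype.card V : ℂ) = (Module.finrank ℂ X : ℂ) ^ 2 := by
  classical
  have h1 : ∀ (φ : X →ₗ[ℂ] ℂ) (x y : X), (Module.finrank ℂ X : ℂ) •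
      ∑ v, φ (trans S (-v) y) • trans S v x = ((Fintype.card V : ℂ) * φ x) • y := by
    intro φ x y
    obtain ⟨c, hc⟩ := hS.exists_eq_smul_one
      (B := ∑ v, trans S v * φ.smulRight x * trans S (-v))
      (fun u => (hS.average_intertwines (AddEquiv.refl V) (fun _ _ => rfl) _ u).symm)
    have h2 := congrArg (LinearMap.trace ℂ X) hc
    have h3 : ∀ v, LinearMap.trace ℂ X (trans S v * φ.smulRight x * trans S (-v)) = φ x := by
      intro v
      rw [LinearMap.trace_mul_comm, ← mul_assoc, hS.trans_neg_mul, one_mul,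
        LinearMap.trace_smulRight]
    rw [map_sum, Finset.sum_congr rfl fun v _ => h3 v, Finset.sum_const, Finset.card_univ,
      nsmul_eq_mul, map_smul, LinearMap.trace_one, smul_eq_mul] at h2
    have h4 := congrArg (fun B : Module.End ℂ X => B y) hc
    simp only [LinearMap.sum_apply, Module.End.mul_apply, LinearMap.smulRight_apply, map_smul,
      LinearMap.smul_apply, Module.End.one_apply] at h4
    rw [h4, h2, mul_comm, mul_smul]
  let b := Module.finBasis ℂ X
  have htr : ∀ B : Module.End ℂ X, LinearMap.trace ℂ X B = ∑ i, b.coord i (B (b i)) := fun B => by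
    rw [LinearMap.trace_eq_matrix_trace ℂ b, Matrix.trace]
    simp [LinearMap.toMatrix_apply]
  have h5 : ∀ i j, (Module.finrank ℂ X : ℂ) *
      ∑ v, b.coord j (trans S (-v) (b j)) * b.coord i (trans S v (b i)) =
        if i = j then (Fintype.card V : ℂ) else 0 := by
    intro i j
    have h6 := congrArg (b.coord i) (h1 (b.coord j) (b i) (b j))
    simp only [map_smul, map_sum, smul_eq_mul] at h6
    rw [h6]
    by_cases hij : i = j
    · subst hij; simp
    · simp [hij]
  have h7 : ∑ i, ∑ j, (Module.finrank ℂ X : ℂ) *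
      ∑ v, b.coord j (trans S (-v) (b j)) * b.coord i (trans S v (b i)) =
      (Module.finrank ℂ X : ℂ) *
        ∑ v, LinearMap.trace ℂ X (trans S (-v)) * LinearMap.trace ℂ X (trans S v) := by
    simp only [htr, Finset.mul_sum, Finset.sum_mul]
    rw [Finset.sum_comm_cycle]
  simp only [h5, hS.trace_trans, neg_eq_zero] at h7
  simp only [Finset.sum_ite_eq, Finset.mem_univ, if_true, Finset.sum_const, Finset.card_univ,
    Fintype.card_fin, nsmul_eq_mul, mul_ite, mul_zero, ite_mul, zero_mul, Finset.sum_ite_eq'] at h7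
  rw [sq]
  exact mul_left_cancel₀ hS.finrank_ne_zero (by simpa using h7)

theorem exists_intertwiner (g : V ≃+ V) (hg : ∀ u v, f (g u) (g v) = f u v) :
    ∃ B : Module.End ℂ X, IsUnit B ∧ ∀ v, B * trans S v = trans S (g v) * B := by
  have := hS.nontrivial
  -- If the averages of all the rank one operators built from `φ` vanished, evaluation at `y` would
  -- give a linear relation among the $T_v$ whose coefficient at $v=0$ is $\varphi(y)\ne0$.
  obtain ⟨y, hy⟩ := exists_ne (0 : X)
  obtain ⟨φ, hφ⟩ := Module.Projective.exists_dual_ne_zero ℂ hy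
  obtain ⟨x, hx⟩ : ∃ x, ∑ v, trans S (g v) * φ.smulRight x * trans S (-v) ≠ 0 := by
    by_contra! h0
    refine hφ ?_
    have h1 : ∑ v, φ (trans S (-v) y) • trans S (g v) = 0 := by
      ext x
      have h2 := congrArg (fun B : Module.End ℂ X => B y) (h0 x)
      simpa only [LinearMap.sum_apply, Module.End.mul_apply, LinearMap.smulRight_apply, map_smul,
        LinearMap.smul_apply, LinearMap.zero_apply] using h2
    have h3 : ∑ v, φ (trans S (-g.symm v) y) • trans S v = 0 := by
      rw [← h1]
      exact (Fintype.sum_equiv g.toEquiv _ _ fun v => by simp).symm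
    simpa [trans_zero] using hS.coeff_eq_zero h3 0
  have h1 := hS.average_intertwines g hg (φ.smulRight x)
  refine ⟨_, ?_, fun v => (h1 v).symm⟩
  -- The kernel of an intertwiner is stable under all $T_v$, so irreducibility leaves only $0$.
  rw [LinearMap.isUnit_iff_ker_eq_bot]
  refine (hS.eq_bot_or_top _ fun v z hz => ?_).resolve_right fun h2 =>
    hx (LinearMap.ker_eq_top.1 h2)
  rw [LinearMap.mem_ker] at hz ⊢
  rw [← Module.End.mul_apply, ← h1, Module.End.mul_apply, hz, map_zero]

end Average

/-! ### The parity operator: an involution of trace one. -/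

section Parity

variable [Fintype V]

omit [FiniteDimensional ℂ X] in
theorem trans_mul_parity (u : V) : trans S u * parity S = parity S * trans S (-u) := by
  rw [parity, mul_smul_comm, smul_mul_assoc, Finset.mul_sum, Finset.sum_mul]
  congr 1
  refine Fintype.sum_equiv (Equiv.addLeft (u + u)) _ _ fun v => ?_
  rw [hS.trans_mul, hS.trans_mul, Equiv.coe_addLeft]
  congr 2
  · simp only [map_neg, map_add, AddMonoidHom.add_apply, hS.alt]
    rw [hS.skew v u]
    simp
  · change u + v = u + u + v + -u
    abel

theorem trace_parity : LinearMap.trace ℂ X (parity S) = 1 := by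
  classical
  simp [parity, hS.trace_trans, hS.finrank_ne_zero]

/-- In the square of $\sum_v T_v$ the coefficient of $T_w$ is $\sum_u\lambda(f(u,w))$, a character
sum that vanishes unless $w=0$. What remains is $|V|=(\dim X)^2$. -/
theorem parity_mul_self : parity S * parity S = 1 := by
  classical
  have h1 : (∑ u, trans S u) * (∑ v, trans S v) = (Fintype.card V : ℂ) • 1 := by
    have h2 : ∀ u, trans S u * (∑ v, trans S v) = ∑ w, lam (f u w) • trans S w := fun u => by
      rw [Finset.mul_sum]
      refine Fintype.sum_equiv (Equiv.addLeft u) _ _ fun v => ?_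
      rw [hS.trans_mul, Equiv.coe_addLeft, map_add, hS.alt, zero_add]
    rw [Finset.sum_mul, Finset.sum_congr rfl fun u _ => h2 u, Finset.sum_comm]
    have h3 : ∀ w, ∑ u, lam (f u w) • trans S w =
        if w = 0 then (Fintype.card V : ℂ) • (1 : Module.End ℂ X) else 0 := fun w => by
      rw [← Finset.sum_smul]
      have h4 := AddChar.sum_eq_ite (lam.compAddMonoidHom (f.flip w))
      simp only [AddChar.compAddMonoidHom_apply, AddMonoidHom.flip_apply] at h4
      rw [h4]
      by_cases hw : w = 0
      · subst hw
        rw [if_pos (by ext; simp), if_pos rfl, trans_zero]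
      · rw [if_neg, if_neg hw, zero_smul]
        intro h5
        exact hw (hS.nondeg w fun u => DFunLike.congr_fun h5 u)
    rw [Finset.sum_congr rfl fun w _ => h3 w]
    simp
  have h0 := hS.finrank_ne_zero
  rw [parity, smul_mul_smul_comm, h1, hS.card_eq, smul_smul]
  field_simp
  simp

end Parity

end IsRegular

end Schrodinger

/-! ### Canonical intertwiners, normalised by determinants on the even and odd parts. -/

section Canonical

variable {R V X : Type*} [CommRing R] [AddCommGroup V] {f : V →+ V →+ R}
  [AddCommGroup X] [Module ℂ X] [Fintype V]

/-- The projection onto the even part of `X`. -/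
def evenProj (S : Representation ℂ (Heis f) X) : Module.End ℂ X := (2 : ℂ)⁻¹ • (1 + parity S)

/-- The projection onto the odd part of `X`. -/
def oddProj (S : Representation ℂ (Heis f) X) : Module.End ℂ X := (2 : ℂ)⁻¹ • (1 - parity S)

/-- `B` intertwines the action of the Heisenberg group with its twist by `g`, and has the same
determinant on the even and on the odd part of `X`. -/
structure IsCanonical (S : Representation ℂ (Heis f) X) (g : V → V) (B : Module.End ℂ X) :
    Prop where
  isUnit : IsUnit B
  comm : ∀ v, B * trans S v = trans S (g v) * B
  det_eq : LinearMap.det (partialOp B (evenProj S)) = LinearMap.det (partialOp B (oddProj S))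

theorem evenProj_sub_oddProj (S : Representation ℂ (Heis f) X) :
    evenProj S - oddProj S = parity S := by
  rw [evenProj, oddProj, ← smul_sub, add_sub_sub_cancel, ← two_smul ℂ, smul_smul]
  simp

/-- Conjugation by `B` only permutes the summands of the parity operator. -/
theorem commute_parity_of_comm {S : Representation ℂ (Heis f) X} {g : V → V}
    (hg : Function.Bijective g) {B : Module.End ℂ X} (hB : ∀ v, B * trans S v = trans S (g v) * B) :
    Commute B (parity S) := by
  change B * parity S = parity S * B
  rw [parity, mul_smul_comm, smul_mul_assoc, Finset.mul_sum, Finset.sum_mul]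
  congr 1
  exact Fintype.sum_bijective g hg _ _ hB

theorem commute_evenProj {S : Representation ℂ (Heis f) X} {B : Module.End ℂ X}
    (hB : Commute B (parity S)) : Commute B (evenProj S) :=
  ((Commute.one_right B).add_right hB).smul_right _

theorem commute_oddProj {S : Representation ℂ (Heis f) X} {B : Module.End ℂ X}
    (hB : Commute B (parity S)) : Commute B (oddProj S) :=
  ((Commute.one_right B).sub_right hB).smul_right _

theorem isCanonical_one (S : Representation ℂ (Heis f) X) : IsCanonical S id 1 :=
  ⟨isUnit_one, fun v => by rw [one_mul, mul_one]; rfl, by rw [partialOp_one, partialOp_one]⟩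

namespace IsRegular

variable {lam : AddChar R ℂ} {S : Representation ℂ (Heis f) X} (hS : IsRegular lam S)
  [FiniteDimensional ℂ X]
include hS

theorem isIdempotentElem_evenProj : IsIdempotentElem (evenProj S) := by
  change evenProj S * evenProj S = evenProj S
  rw [evenProj, smul_mul_smul_comm, add_mul, mul_add, mul_add, hS.parity_mul_self, one_mul,
    one_mul, mul_one, add_comm (parity S), ← two_smul ℂ (1 + parity S), smul_smul]
  norm_num

theorem isIdempotentElem_oddProj : IsIdempotentElem (oddProj S) := by
  change oddProj S * oddProj S = oddProj S
  rw [oddProj, smul_mul_smul_comm, sub_mul, mul_sub, mul_sub, hS.parity_mul_self, one_mul,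
    one_mul, mul_one, ← neg_sub (1 : Module.End ℂ X) (parity S), sub_neg_eq_add,
    ← two_smul ℂ (1 - parity S), smul_smul]
  norm_num

theorem exists_isCanonical (g : V ≃+ V) (hg : ∀ u v, f (g u) (g v) = f u v) :
    ∃ B, IsCanonical S g B := by
  obtain ⟨B, hB, hc⟩ := hS.exists_intertwiner g hg
  have hP := commute_parity_of_comm g.bijective hc
  have he := hS.isIdempotentElem_evenProj
  have ho := hS.isIdempotentElem_oddProj
  have hα := (isUnit_partialOp he hB (commute_evenProj hP)).map LinearMap.det
  have hβ := (isUnit_partialOp ho hB (commute_oddProj hP)).map LinearMap.det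
  obtain ⟨k, hk, hk'⟩ := exists_rank_det_partialOp_smul he
  obtain ⟨m, hm, hm'⟩ := exists_rank_det_partialOp_smul ho
  -- Parity is the difference of the even and odd projections, so its trace $1$ is the difference of
  -- their ranks.
  have hkm : k = m + 1 := by
    have h1 := hS.trace_parity
    rw [← evenProj_sub_oddProj, map_sub, hk, hm, sub_eq_iff_eq_add, add_comm] at h1
    exact_mod_cast h1
  set α := LinearMap.det (partialOp B (evenProj S))
  set β := LinearMap.det (partialOp B (oddProj S))
  have hα0 := hα.ne_zero
  have hc0 : β / α ≠ 0 := div_ne_zero hβ.ne_zero hα.ne_zero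
  -- Scaling by $c$ replaces $(\alpha,\beta)$ by $(c^{m+1}\alpha,c^m\beta)$; equality forces
  -- $c=\beta/\alpha$.
  refine ⟨(β / α) • B, ?_, fun v => ?_, ?_⟩
  · exact hB.smul (Units.mk0 _ hc0)
  · rw [smul_mul_assoc, hc, mul_smul_comm]
  · have h2 : (β / α) • B = ((β / α) • 1) * B := by rw [smul_mul_assoc, one_mul]
    rw [h2, ← partialOp_mul he (commute_evenProj hP), ← partialOp_mul ho (commute_oddProj hP),
      map_mul, map_mul, hk', hm', hkm, pow_succ, mul_assoc]
    change _ * (β / α * α) = _ * β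
    rw [div_mul_cancel₀ _ hα0]

/-- Schur's lemma gives $C=cB$, and comparing determinants gives $c^{m+1}=c^m$. Invertibility of `C`
is what allows cancelling, including in the case $m=0$. -/
theorem eq_of_isCanonical {g : V → V} (hg : Function.Bijective g) {B C : Module.End ℂ X}
    (hB : IsCanonical S g B) (hC : IsCanonical S g C) : B = C := by
  have he := hS.isIdempotentElem_evenProj
  have ho := hS.isIdempotentElem_oddProj
  have hP := commute_parity_of_comm hg hB.comm
  obtain ⟨b, hb⟩ := hB.isUnit
  have h1 : ∀ v, Commute (C * ↑b⁻¹ : Module.End ℂ X) (trans S v) := fun v => by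
    obtain ⟨w, rfl⟩ := hg.2 v
    have h2 := hB.comm w
    rw [← hb] at h2
    have h3 : (↑b⁻¹ : Module.End ℂ X) * trans S (g w) = trans S w * ↑b⁻¹ := by
      rw [Units.inv_mul_eq_iff_eq_mul, ← mul_assoc, h2, mul_assoc, Units.mul_inv, mul_one]
    change _ * _ = _ * _
    rw [mul_assoc, h3, ← mul_assoc, hC.comm, mul_assoc]
  obtain ⟨c, hc⟩ := hS.exists_eq_smul_one h1
  have h2 : C = (c • 1) * B := by rw [← hc, ← hb, mul_assoc, Units.inv_mul, mul_one]
  obtain ⟨k, hk, hk'⟩ := exists_rank_det_partialOp_smul he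
  obtain ⟨m, hm, hm'⟩ := exists_rank_det_partialOp_smul ho
  have hkm : k = m + 1 := by
    have h1 := hS.trace_parity
    rw [← evenProj_sub_oddProj, map_sub, hk, hm, sub_eq_iff_eq_add, add_comm] at h1
    exact_mod_cast h1
  have hα := ((isUnit_partialOp he hC.isUnit
    (commute_evenProj (commute_parity_of_comm hg hC.comm))).map LinearMap.det).ne_zero
  have h3 := hC.det_eq
  rw [h2, ← partialOp_mul he (commute_evenProj hP), ← partialOp_mul ho (commute_oddProj hP),
    map_mul, map_mul, hk', hm', hkm, hB.det_eq] at h3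
  rw [h2, ← partialOp_mul he (commute_evenProj hP), map_mul, hB.det_eq, hk', hkm] at hα
  have h4 := mul_right_cancel₀ (right_ne_zero_of_mul hα) h3
  have h5 : c = 1 := by
    have h6 := left_ne_zero_of_mul hα
    rw [pow_succ] at h4 h6
    exact mul_left_cancel₀ (left_ne_zero_of_mul h6) (by rw [h4, mul_one])
  rw [h2, h5, one_smul, one_mul]

theorem isCanonical_mul {g g' : V → V}
    (hg' : Function.Bijective g') {B B' : Module.End ℂ X} (hB : IsCanonical S g B)
    (hB' : IsCanonical S g' B') : IsCanonical S (g ∘ g') (B * B') := by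
  have hP := commute_parity_of_comm hg' hB'.comm
  refine ⟨hB.isUnit.mul hB'.isUnit, fun v => ?_, ?_⟩
  · rw [mul_assoc, hB'.comm, ← mul_assoc, hB.comm, mul_assoc]; rfl
  · rw [← partialOp_mul hS.isIdempotentElem_evenProj (commute_evenProj hP),
      ← partialOp_mul hS.isIdempotentElem_oddProj (commute_oddProj hP), map_mul, map_mul,
      hB.det_eq, hB'.det_eq]

/-- A group acting on the Heisenberg group acts on `X` by canonical intertwining operators. -/
theorem exists_canonicalRep {G : Type*} [Group G] (ρ : G → V ≃+ V) (hρ1 : ∀ v, ρ 1 v = v)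
    (hρm : ∀ g g' v, ρ (g * g') v = ρ g (ρ g' v)) (hρ : ∀ g u v, f (ρ g u) (ρ g v) = f u v) :
    ∃ W : Representation ℂ G X, ∀ g, IsCanonical S (ρ g) (W g) := by
  choose W hW using fun g => hS.exists_isCanonical (ρ g) (hρ g)
  refine ⟨⟨⟨W, ?_⟩, fun g g' => ?_⟩, hW⟩
  · refine hS.eq_of_isCanonical (ρ 1).bijective (hW 1) ?_
    rw [show ⇑(ρ 1) = id from funext hρ1]
    exact isCanonical_one S
  · refine hS.eq_of_isCanonical (ρ (g * g')).bijective (hW _) ?_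
    rw [show ⇑(ρ (g * g')) = ρ g ∘ ρ g' from funext (hρm g g')]
    exact hS.isCanonical_mul (ρ g').bijective (hW g) (hW g')

end IsRegular

end Canonical

/-! ### Fixed points of isotropic subgroups -/

/-- An arbitrary linear order, with no compatibility with the group law, selects one member of each
pair $\{x,-x\}$. -/
theorem exists_odd_sign {G : Type*} [AddGroup G] (hG : ∀ x : G, x = -x → x = 0) :
    ∃ c : G → ℂ, (∀ x, c (-x) = -c x) ∧ c 0 = 0 ∧ ∀ x ≠ 0, c x * c x = 1 := by
  classical
  let _ : LinearOrder G := IsWellOrder.linearOrder WellOrderingRel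
  refine ⟨fun x => if x = 0 then 0 else if x < -x then 1 else -1, fun x => ?_, by simp,
    fun x hx => ?_⟩
  · by_cases hx : x = 0
    · simp [hx]
    · rcases lt_trichotomy x (-x) with h | h | h
      · simp [hx, h, h.not_gt]
      · exact absurd (hG x h) hx
      · simp [hx, h, h.not_gt]
  · by_cases h : x < -x <;> simp [hx, h]

section Isotropic

variable {R V X : Type*} [CommRing R] [AddCommGroup V] {f : V →+ V →+ R}
  [AddCommGroup X] [Module ℂ X]

/-- The projection onto the `ψ`-isotypic part of `X` under `(0,N)`. -/
def isotypicProj (S : Representation ℂ (Heis f) X) (N : AddSubgroup V) [Fintype N]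
    (ψ : AddChar N ℂ) : Module.End ℂ X :=
  (Fintype.card N : ℂ)⁻¹ • ∑ w : N, ψ (-w) • trans S (w : V)

namespace IsRegular

variable {lam : AddChar R ℂ} {S : Representation ℂ (Heis f) X} (hS : IsRegular lam S)
  {N : AddSubgroup V} [Fintype N] (hN : ∀ w ∈ N, ∀ w' ∈ N, f w w' = 0)

section

include hS hN

theorem trans_mul_isotypicProj (w : N) (ψ : AddChar N ℂ) :
    trans S (w : V) * isotypicProj S N ψ = ψ w • isotypicProj S N ψ := by
  rw [isotypicProj, mul_smul_comm, smul_comm (ψ w) (Fintype.card N : ℂ)⁻¹,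
    Finset.mul_sum, Finset.smul_sum (r := ψ w)]
  refine congrArg _ (Fintype.sum_equiv (Equiv.addLeft w) _ _ fun v => ?_)
  rw [mul_smul_comm, hS.trans_mul, hN _ w.2 _ v.2, AddChar.map_zero_eq_one, one_smul, smul_smul,
    ← AddChar.map_add_eq_mul]
  congr 2
  change -v = w + -(w + v)
  abel

theorem isotypicProj_mul [DecidableEq (AddChar N ℂ)] (ψ χ : AddChar N ℂ) :
    isotypicProj S N ψ * isotypicProj S N χ = if ψ = χ then isotypicProj S N χ else 0 := by
  have h1 := AddChar.sum_eq_ite (χ - ψ)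
  have h2 : ∀ w : N, ψ (-w) • trans S (w : V) * isotypicProj S N χ =
      (χ - ψ) w • isotypicProj S N χ := fun w => by
    rw [smul_mul_assoc, hS.trans_mul_isotypicProj hN, smul_smul, AddChar.sub_apply, mul_comm]
  conv_lhs => rw [isotypicProj]
  rw [smul_mul_assoc, Finset.sum_mul, Finset.sum_congr rfl fun w _ => h2 w, ← Finset.sum_smul,
    h1, smul_smul]
  simp only [sub_eq_zero, eq_comm (a := χ)]
  split_ifs with h
  · rw [inv_mul_cancel₀ (by simp), one_smul]
  · rw [mul_zero, zero_smul]

end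

theorem sum_isotypicProj (S : Representation ℂ (Heis f) X) :
    ∑ ψ, isotypicProj S N ψ = 1 := by
  classical
  simp only [isotypicProj]
  rw [← Finset.smul_sum, Finset.sum_comm]
  simp only [← Finset.sum_smul, AddChar.sum_apply_eq_ite, neg_eq_zero]
  simp [trans_zero]

section

include hS

/-- Parity inverts each $T_w$, so it exchanges opposite characters and preserves only the trivial
isotypic part. -/
theorem parity_mul_isotypicProj [Fintype V] (ψ : AddChar N ℂ) :
    parity S * isotypicProj S N ψ = isotypicProj S N (-ψ) * parity S := by
  rw [isotypicProj, isotypicProj, mul_smul_comm, smul_mul_assoc, Finset.mul_sum, Finset.sum_mul]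
  congr 1
  refine Fintype.sum_equiv (Equiv.neg N) _ _ fun w => ?_
  rw [mul_smul_comm, smul_mul_assoc, hS.trans_mul_parity, AddChar.neg_apply]
  simp

end

theorem isotypicProj_zero (S : Representation ℂ (Heis f) X) :
    isotypicProj S N 0 = (Fintype.card N : ℂ)⁻¹ • ∑ w : N, trans S (w : V) := by
  simp [isotypicProj]

section

include hS hN

theorem range_isotypicProj_zero (x : X) : isotypicProj S N 0 x ∈ fixedPts S (N : Set V) := by
  intro u hu
  have := congrArg (fun B : Module.End ℂ X => B x) (hS.trans_mul_isotypicProj hN ⟨u, hu⟩ 0)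
  simpa [trans] using this

end

theorem isotypicProj_zero_apply_of_mem {x : X} (hx : x ∈ fixedPts S (N : Set V)) :
    isotypicProj S N 0 x = x := by
  have h1 : ∀ w : N, trans S (w : V) x = x := fun w => hx w w.2
  rw [isotypicProj_zero, LinearMap.smul_apply, LinearMap.sum_apply]
  simp only [h1, Finset.sum_const, Finset.card_univ]
  rw [← Nat.cast_smul_eq_nsmul ℂ, smul_smul, inv_mul_cancel₀ (by simp), one_smul]

include hS

/-- For each $w\in N$ only the summand $v=-w$ of parity contributes to the trace. The value says
that, for isotropic $N$, the fixed space of $(0,N)$ also has even part one dimension larger than its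
odd part. -/
theorem trace_isotypicProj_mul_parity [Fintype V] [FiniteDimensional ℂ X] :
    LinearMap.trace ℂ X (isotypicProj S N 0 * parity S) = 1 := by
  classical
  have h0 := hS.finrank_ne_zero
  have h1 : ∀ w : V, LinearMap.trace ℂ X (trans S w * ∑ v, trans S v) = Module.finrank ℂ X := by
    intro w
    rw [Finset.mul_sum, map_sum, Finset.sum_eq_single (-w)]
    · rw [hS.trans_mul_neg, LinearMap.trace_one]
    · intro v _ hv
      rw [hS.trans_mul, map_smul, hS.trace_trans_of_ne, smul_zero]
      exact fun h => hv (eq_neg_of_add_eq_zero_right h)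
    · simp
  rw [isotypicProj_zero, parity, smul_mul_smul_comm, map_smul, Finset.sum_mul, map_sum]
  simp only [h1, Finset.sum_const, Finset.card_univ]
  rw [nsmul_eq_mul, smul_eq_mul]
  have h2 : (Fintype.card N : ℂ) ≠ 0 := by simp
  field_simp

/-- The fixed points of an isotropic subgroup form an irreducible module for its orthogonal. -/
theorem fixedPts_le_of_stable [Fintype V] [FiniteDimensional ℂ X] {Z : Submodule ℂ X} (hZ0 : Z ≠ ⊥)
    (hZ : Z ≤ fixedPts S (N : Set V))
    (hst : ∀ u, (∀ w ∈ N, lam (f w u + f w u) = 1) → ∀ z ∈ Z, trans S u z ∈ Z) :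
    fixedPts S (N : Set V) ≤ Z := by
  classical
  -- By character orthogonality on $N$, projecting $T_uz$ to the fixed points returns $T_uz$ if $u$
  -- is orthogonal to $N$ and $0$ otherwise.
  have key : ∀ u, ∀ z ∈ Z, isotypicProj S N 0 (trans S u z) ∈ Z := by
    intro u z hz
    have h1 : isotypicProj S N 0 (trans S u z) =
        ((Fintype.card N : ℂ)⁻¹ * ∑ w : N, lam (f w u + f w u)) • trans S u z := by
      rw [isotypicProj_zero, LinearMap.smul_apply, LinearMap.sum_apply, mul_smul, Finset.sum_smul]
      congr 1
      refine Finset.sum_congr rfl fun w _ => ?_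
      rw [← Module.End.mul_apply, hS.trans_comm, LinearMap.smul_apply, Module.End.mul_apply]
      congr 2
      exact hZ hz w w.2
    have h2 := AddChar.sum_eq_ite (lam.compAddMonoidHom ((f.flip u + f.flip u).comp N.subtype))
    simp only [AddChar.compAddMonoidHom_apply, AddMonoidHom.comp_apply, AddMonoidHom.add_apply,
      AddMonoidHom.flip_apply, AddSubgroup.subtype_apply] at h2
    rw [h1, h2]
    split_ifs with h
    · rw [inv_mul_cancel₀ (by simp), one_smul]
      exact hst u (fun w hw => DFunLike.congr_fun h ⟨w, hw⟩) z hz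
    · simp
  -- The translates of `Z` span a stable subspace, hence all of $X$; projecting a fixed vector,
  -- which does not change it, then puts it in `Z`.
  let Y : Submodule ℂ X := Submodule.span ℂ {x | ∃ u, ∃ z ∈ Z, x = trans S u z}
  have hY : Y = ⊤ := by
    refine (hS.eq_bot_or_top Y fun v x hx => ?_).resolve_left ?_
    · induction hx using Submodule.span_induction with
      | mem x hx =>
        obtain ⟨u, z, hz, rfl⟩ := hx
        rw [← Module.End.mul_apply, hS.trans_mul]
        exact Y.smul_mem _ (Submodule.subset_span ⟨_, z, hz, rfl⟩)
      | zero => simp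
      | add x y _ _ hx hy => rw [map_add]; exact Y.add_mem hx hy
      | smul c x _ hx => rw [map_smul]; exact Y.smul_mem _ hx
    · intro h
      refine hZ0 (eq_bot_iff.2 fun z hz => ?_)
      rw [← h]
      exact Submodule.subset_span ⟨0, z, hz, by rw [trans_zero]; rfl⟩
  intro x hx
  have hxY : x ∈ Y := hY ▸ Submodule.mem_top
  rw [← isotypicProj_zero_apply_of_mem hx]
  clear hx
  induction hxY using Submodule.span_induction with
  | mem x hx =>
    obtain ⟨u, z, hz, rfl⟩ := hx
    exact key u z hz
  | zero => simp
  | add x y _ _ hx hy => rw [map_add]; exact Z.add_mem hx hy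
  | smul c x _ hx => rw [map_smul]; exact Z.smul_mem _ hx

include hN

/-- A canonical operator that commutes with `(0,N)` and acts on the fixed points of `(0,N)` as a
scalar acts trivially there. -/
theorem eq_one_of_isCanonical [Fintype V] [FiniteDimensional ℂ X] {g : V → V}
    (hg : Function.Bijective g) (hgN : ∀ w ∈ N, g w = w) {B : Module.End ℂ X}
    (hB : IsCanonical S g B) {c : ℂ} (hc : ∀ x ∈ fixedPts S (N : Set V), B x = c • x) : c = 1 := by
  classical
  set e := isotypicProj S N 0 with he
  have hBψ : ∀ ψ : AddChar N ℂ, Commute B (isotypicProj S N ψ) := fun ψ => by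
    refine Commute.smul_right (Commute.sum_right _ _ _ fun w _ => Commute.smul_right ?_ _) _
    change B * trans S (w : V) = trans S (w : V) * B
    rw [hB.comm, hgN w w.2]
  -- No nontrivial character of $N$ is its own inverse, because doubling is bijective on $N$.
  obtain ⟨s, hs, hs0, hs1⟩ := exists_odd_sign (G := AddChar N ℂ) fun ψ hψ => by
    ext w
    have hinj : Function.Injective (fun u : N => u + u) := fun a b hab => by
      have h1 : (a : V) + a = b + b := congrArg Subtype.val hab
      have h2 : (a - b : V) + (a - b) = (a + a) - (b + b) := by abel
      exact Subtype.ext (sub_eq_zero.1 (hS.double_eq_zero (by rw [h2, h1, sub_self])))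
    obtain ⟨u, hu⟩ := Finite.injective_iff_surjective.1 hinj w
    have hu' : u + u = w := hu
    have h1 := DFunLike.congr_fun hψ u
    rw [AddChar.neg_apply] at h1
    rw [← hu', AddChar.map_add_eq_mul]
    nth_rewrite 2 [h1]
    rw [← AddChar.map_add_eq_mul, add_neg_cancel, AddChar.map_zero_eq_one, AddChar.zero_apply]
  -- `D` vanishes on the fixed points of $(0,N)$ and is a sign on every other isotypic part; oddness
  -- of the signs makes it anticommute with parity.
  set D : Module.End ℂ X := ∑ ψ, s ψ • isotypicProj S N ψ with hD
  have hDψ : ∀ ψ, D * isotypicProj S N ψ = s ψ • isotypicProj S N ψ := fun ψ => by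
    rw [hD, Finset.sum_mul]
    simp only [smul_mul_assoc, hS.isotypicProj_mul hN, smul_ite, smul_zero]
    simp
  have hψD : ∀ ψ, isotypicProj S N ψ * D = s ψ • isotypicProj S N ψ := fun ψ => by
    rw [hD, Finset.mul_sum]
    simp only [mul_smul_comm, hS.isotypicProj_mul hN, smul_ite, smul_zero]
    simp
  have hDe : D * e = 0 := by rw [hDψ, hs0, zero_smul]
  have heD : e * D = 0 := by rw [hψD, hs0, zero_smul]
  have hee : e * e = e := by rw [he, hS.isotypicProj_mul hN, if_pos rfl]
  have hDD : D * D = 1 - e := by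
    nth_rewrite 1 [hD]
    rw [Finset.sum_mul, ← sum_isotypicProj (N := N) S, eq_sub_iff_add_eq,
      ← Finset.add_sum_erase _ _ (Finset.mem_univ (0 : AddChar N ℂ)),
      ← Finset.add_sum_erase _ _ (Finset.mem_univ (0 : AddChar N ℂ)), hs0, zero_smul, zero_mul,
      zero_add, add_comm]
    congr 1
    refine Finset.sum_congr rfl fun ψ hψ => ?_
    rw [smul_mul_assoc, hψD, smul_smul, hs1 ψ (Finset.ne_of_mem_erase hψ), one_smul]
  have hPe : parity S * e = e * parity S := by
    rw [he, hS.parity_mul_isotypicProj, neg_zero]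
  have hPD : parity S * D = -(D * parity S) := by
    rw [hD, Finset.mul_sum, Finset.sum_mul, ← Finset.sum_neg_distrib]
    refine Fintype.sum_equiv (Equiv.neg _) _ _ fun ψ => ?_
    rw [Equiv.neg_apply, mul_smul_comm, hS.parity_mul_isotypicProj, hs, neg_smul, neg_mul, neg_neg,
      smul_mul_assoc]
  have hBe : Commute B e := hBψ 0
  have hBD : Commute B D := Commute.sum_right _ _ _ fun ψ _ => (hBψ ψ).smul_right _
  have hBP := commute_parity_of_comm hg hB.comm
  have hep := hS.isIdempotentElem_evenProj
  have hop := hS.isIdempotentElem_oddProj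
  have hce : Commute e (evenProj S) := commute_evenProj hPe.symm
  have hco : Commute e (oddProj S) := commute_oddProj hPe.symm
  have hce' : Commute (1 - e) (evenProj S) := (Commute.one_left _).sub_left hce
  have hco' : Commute (1 - e) (oddProj S) := (Commute.one_left _).sub_left hco
  have hei : IsIdempotentElem e := hee
  have hq1 : IsIdempotentElem (e * evenProj S) := hei.mul_of_commute hce hep
  have hq2 : IsIdempotentElem (e * oddProj S) := hei.mul_of_commute hco hop
  have hr1 : IsIdempotentElem ((1 - e) * evenProj S) := hei.one_sub.mul_of_commute hce' hep
  have hB1 : Commute B (1 - e) := (Commute.one_right B).sub_right hBe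
  have hBq1 : Commute B (e * evenProj S) := hBe.mul_right (commute_evenProj hBP)
  have hBr1 : Commute B ((1 - e) * evenProj S) := hB1.mul_right (commute_evenProj hBP)
  have hBr2 : Commute B ((1 - e) * oddProj S) := hB1.mul_right (commute_oddProj hBP)
  have he1 : e * (1 - e) = 0 := by rw [mul_sub, mul_one, hee, sub_self]
  have horth : ∀ a b : Module.End ℂ X, Commute e a → e * a * ((1 - e) * b) = 0 := by
    intro a b hab
    have h : e * a = a * e := hab
    rw [h, mul_assoc, ← mul_assoc e, he1, zero_mul, mul_zero]
  have hsplit : ∀ a : Module.End ℂ X, e * a + (1 - e) * a = a := fun a => by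
    rw [← add_mul, add_sub_cancel, one_mul]
  have hdet := hB.det_eq
  rw [← hsplit (evenProj S), ← hsplit (oddProj S),
    ← partialOp_mul_of_orthogonal (horth _ _ hce) hBr1,
    ← partialOp_mul_of_orthogonal (horth _ _ hco) hBr2, map_mul, map_mul] at hdet
  -- Adding `e` makes `D` invertible on all of $X$ without changing it off the fixed points.
  have hNN : (D + e) * (D + e) = 1 := by
    rw [add_mul, mul_add, mul_add, hDD, hDe, heD, hee, add_zero, zero_add, sub_add_cancel]
  have hDev : D * evenProj S = oddProj S * D := by
    rw [evenProj, oddProj, mul_smul_comm, smul_mul_assoc, mul_add, sub_mul, hPD, mul_one, one_mul,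
      sub_neg_eq_add]
  -- The even and odd parts of the complement are exchanged by an involution commuting with `B`, so
  -- their determinants cancel and only the fixed points remain in `hdet`.
  have hconj : (D + e) * ((1 - e) * evenProj S) * (D + e) = (1 - e) * oddProj S := by
    rw [← mul_assoc (D + e), add_mul, he1, mul_sub, mul_one, hDe, sub_zero, add_zero, hDev,
      mul_assoc, mul_add, hDD, hDe, add_zero]
    exact hco'.symm
  rw [det_partialOp_conj hNN (hBD.add_right hBe).symm hconj] at hdet
  have hu1 := ((isUnit_partialOp hr1 hB.isUnit hBr1).map LinearMap.det).ne_zero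
  rw [det_partialOp_conj hNN (hBD.add_right hBe).symm hconj] at hu1
  have hu2 := ((isUnit_partialOp hq1 hB.isUnit hBq1).map LinearMap.det).ne_zero
  have hdet' := mul_right_cancel₀ hu1 hdet
  have hBce : B * e = c • e := by
    ext x
    exact hc _ (hS.range_isotypicProj_zero hN x)
  have hpart : ∀ a : Module.End ℂ X, partialOp B (e * a) = partialOp (c • 1) (e * a) := fun a => by
    rw [partialOp, partialOp, ← mul_assoc, hBce, smul_mul_assoc, smul_mul_assoc, one_mul]
  obtain ⟨k, hk, hk'⟩ := exists_rank_det_partialOp_smul hq1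
  obtain ⟨m, hm, hm'⟩ := exists_rank_det_partialOp_smul hq2
  have hkm : k = m + 1 := by
    have h1 := hS.trace_isotypicProj_mul_parity (N := N)
    rw [← evenProj_sub_oddProj, mul_sub, map_sub, hk, hm, sub_eq_iff_eq_add, add_comm] at h1
    exact_mod_cast h1
  rw [hpart, hk', hkm, pow_succ] at hu2
  rw [hpart, hpart, hk', hm', hkm, pow_succ] at hdet'
  exact mul_left_cancel₀ (left_ne_zero_of_mul hu2) (by rw [hdet', mul_one])

end IsRegular

end Isotropic

/-! ### Lifting unitary transformations -/

section Lifting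

variable {A : Type*} [CommRing A] {σ : A →+* A} {V : Type*} [AddCommGroup V] [Module A V]
  {h : V →ₛₗ[σ] V →ₗ[A] A}

/-- A basis shows that the finite module $V$ and its dual have the same cardinality, so injectivity
suffices. -/
theorem form_bijective [Finite A] [Module.Free A V] [Module.Finite A V]
    (hh : IsNondegSkewHermitian h) : Function.Bijective h := by
  have : Finite V := Module.finite_of_finite A
  let b := Module.Free.chooseBasis A V
  have e : V ≃ (V →ₗ[A] A) := b.equivFun.toEquiv.trans (b.constr ℕ).toEquiv
  exact ⟨hh.nondeg, (Finite.injective_iff_surjective_of_equiv e).1 hh.nondeg⟩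

/-- Expand $x$ in vectors $y_i$ representing the coordinate functionals of a basis: the coefficients
are $\sigma(h(x,b_i))$. -/
theorem mem_smul_top_of_form_mem [Finite A] [Module.Free A V] [Module.Finite A V]
    (hh : IsNondegSkewHermitian h) (hσ : ∀ a, σ (σ a) = a) {I : Ideal A} (hI : I ≤ I.comap σ)
    {x : V} (hx : ∀ v, h x v ∈ I) : x ∈ I • (⊤ : Submodule A V) := by
  let b := Module.Free.chooseBasis A V
  choose y hy using fun i => (form_bijective hh).2 (b.coord i)
  have h1 : x = ∑ i, σ (h x (b i)) • y i := by
    refine hh.nondeg (b.ext fun j => ?_)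
    simp [map_sum, hσ, hy]
  rw [h1]
  exact Submodule.sum_mem _ fun i _ => Submodule.smul_mem_smul (hI (hx _)) Submodule.mem_top

/-- The defect of `g` from being an isometry. -/
def defect (h : V →ₛₗ[σ] V →ₗ[A] A) (g : V →ₗ[A] V) : V →ₛₗ[σ] V →ₗ[A] A :=
  LinearMap.mk₂'ₛₗ σ (RingHom.id A) (fun u v => h (g u) (g v) - h u v)
    (fun u u' v => by simp; abel) (fun c u v => by simp [mul_sub])
    (fun u v v' => by simp; abel) (fun c u v => by simp [mul_sub])

theorem defect_apply (g : V →ₗ[A] V) (u v : V) :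
    defect h g u v = h (g u) (g v) - h u v := rfl

theorem form_mem_mul_left {F : V →ₛₗ[σ] V →ₗ[A] A} {I J : Ideal A} (hI : I ≤ I.comap σ)
    (hF : ∀ u v, F u v ∈ J) {u : V} (hu : u ∈ I • (⊤ : Submodule A V)) (v : V) :
    F u v ∈ I * J := by
  induction hu using Submodule.smul_induction_on' with
  | smul a ha w _ =>
    rw [map_smulₛₗ, LinearMap.smul_apply]
    exact Ideal.mul_mem_mul (hI ha) (hF _ _)
  | add x _ y _ hx hy =>
    rw [map_add, LinearMap.add_apply]
    exact Ideal.add_mem _ hx hy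

theorem form_mem_mul_right {F : V →ₛₗ[σ] V →ₗ[A] A} {I J : Ideal A} {u : V}
    (hF : ∀ v, F u v ∈ J) {v : V} (hv : v ∈ I • (⊤ : Submodule A V)) :
    F u v ∈ I * J := by
  induction hv using Submodule.smul_induction_on' with
  | smul a ha w _ =>
    rw [map_smul]
    exact Ideal.mul_mem_mul ha (hF _)
  | add x _ y _ hx hy =>
    rw [map_add]
    exact Ideal.add_mem _ hx hy

/-- An isometry modulo `I` can be corrected to an isometry modulo `I²`. -/
theorem exists_defect_mem_sq [Finite A] [Module.Free A V] [Module.Finite A V]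
    (hh : IsNondegSkewHermitian h) (hσ : ∀ a, σ (σ a) = a) (h2 : IsUnit (2 : A)) {I : Ideal A}
    (hI : I ≤ I.comap σ) (g : V →ₗ[A] V) (hg : ∀ u v, defect h g u v ∈ I) :
    ∃ g' : V →ₗ[A] V, (∀ v, g' v - g v ∈ I • (⊤ : Submodule A V)) ∧
      ∀ u v, defect h g' u v ∈ I * I := by
  obtain ⟨c, hc⟩ := h2.exists_right_inv
  have hσc : σ c = c := by
    have h3 : 2 * σ c = 1 := by
      have := congrArg σ hc
      rwa [map_mul, map_ofNat, map_one] at this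
    calc σ c = (2 * c) * σ c := by rw [hc, one_mul]
      _ = c * (2 * σ c) := by ring
      _ = c := by rw [h3, mul_one]
  choose y hy using (form_bijective hh).2
  -- Newton correction $g(1+Y)$, with $Y$ representing $-\tfrac12$ of the defect. As the defect is
  -- skew, $h(Yu,v)$ and $h(u,Yv)$ each contribute half, which cancels the defect to first order.
  let Y : V →ₗ[A] V :=
    { toFun := fun u => y (-c • defect h g u)
      map_add' := fun u v => hh.nondeg (by
        rw [hy, map_add, map_add, hy, hy, smul_add])
      map_smul' := fun a u => hh.nondeg (by
        rw [hy, RingHom.id_apply, map_smulₛₗ, map_smulₛₗ, hy, smul_comm]) }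
  have hY : ∀ u v, h (Y u) v = -c * defect h g u v := fun u v => by
    change h (y _) v = _
    rw [hy, LinearMap.smul_apply, smul_eq_mul]
  have hYI : ∀ u, Y u ∈ I • (⊤ : Submodule A V) := fun u =>
    mem_smul_top_of_form_mem hh hσ hI fun v => by
      rw [hY]; exact I.mul_mem_left _ (hg u v)
  have hskew : ∀ u v, σ (defect h g v u) = -defect h g u v := fun u v => by
    rw [defect_apply, defect_apply, map_sub, hh.skew v u, hh.skew (g v) (g u)]
    abel
  have hY' : ∀ u v, h u (Y v) = -c * defect h g u v := fun u v => by
    rw [hh.skew, hY, map_mul, map_neg, hσc, hskew]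
    ring
  refine ⟨g + g ∘ₗ Y, fun v => ?_, fun u v => ?_⟩
  · rw [LinearMap.add_apply, add_sub_cancel_left]
    exact Submodule.smul_top_le_comap_smul_top I g (hYI v)
  · have h3 : defect h (g + g ∘ₗ Y) u v = defect h g (Y u) v + defect h g u (Y v) +
        defect h g (Y u) (Y v) + h (Y u) (Y v) +
          (defect h g u v + h (Y u) v + h u (Y v)) := by
      simp only [defect_apply, LinearMap.add_apply, LinearMap.comp_apply, map_add]
      ring
    have h4 : defect h g u v + h (Y u) v + h u (Y v) = 0 := by
      rw [hY, hY']
      linear_combination (-defect h g u v) * hc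
    rw [h3, h4, add_zero]
    refine Ideal.add_mem _ (Ideal.add_mem _ (Ideal.add_mem _ ?_ ?_) ?_) ?_
    · exact form_mem_mul_left hI hg (hYI u) v
    · exact form_mem_mul_right (hg u) (hYI v)
    · exact form_mem_mul_right (hg _) (hYI v)
    · exact form_mem_mul_right (fun w => by rw [hY]; exact I.mul_mem_left _ (hg _ _)) (hYI v)

/-- Freeness lifts the isometry to a linear map with defect in $I$; two Newton corrections push the
defect into $I^4=0$. Both change the map only modulo $I$, and an exact isometry is injective by
nondegeneracy. -/
theorem redU_surjective [Finite A] [Module.Free A V] [Module.Finite A V]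
    (hh : IsNondegSkewHermitian h) (hσ : ∀ a, σ (σ a) = a) (h2 : IsUnit (2 : A)) {I : Ideal A}
    (hI : I ≤ I.comap σ) (hI4 : I * I * (I * I) = ⊥) : Function.Surjective (redU I h hI) := by
  intro k
  have : Finite V := Module.finite_of_finite A
  let k' : V →ₗ[A] RedMod I V :=
    { toFun := fun v => k.1 (redVec I v)
      map_add' := fun u v => map_add k.1 (redVec I u) (redVec I v)
      map_smul' := fun a v => map_smul k.1 (Ideal.Quotient.mk I a) (redVec I v) }
  obtain ⟨g, hg⟩ := Module.projective_lifting_property (I • (⊤ : Submodule A V)).mkQ k'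
    (Submodule.mkQ_surjective _)
  have hg' : ∀ v, redVec I (g v) = k.1 (redVec I v) := fun v => LinearMap.congr_fun hg v
  have hd : ∀ u v, defect h g u v ∈ I := fun u v => by
    rw [defect_apply, ← Ideal.Quotient.eq, ← redForm_mk I h hI, ← redForm_mk I h hI, hg', hg']
    exact k.2 _ _
  obtain ⟨g₁, h1, hd1⟩ := exists_defect_mem_sq hh hσ h2 hI g hd
  have hII : I * I ≤ (I * I).comap σ := by
    rw [Ideal.mul_le]
    intro a ha b hb
    rw [Ideal.mem_comap, map_mul]
    exact Ideal.mul_mem_mul (hI ha) (hI hb)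
  obtain ⟨g₂, h3, hd2⟩ := exists_defect_mem_sq hh hσ h2 hII g₁ hd1
  have hiso : ∀ u v, h (g₂ u) (g₂ v) = h u v := fun u v => by
    have := hd2 u v
    rw [hI4, Ideal.mem_bot, defect_apply] at this
    exact sub_eq_zero.1 this
  have hinj : Function.Injective g₂ := by
    rw [injective_iff_map_eq_zero]
    intro u hu
    refine hh.nondeg (LinearMap.ext fun v => ?_)
    rw [← hiso, hu]
    simp
  refine ⟨⟨LinearEquiv.ofBijective g₂ ⟨hinj, Finite.injective_iff_surjective.1 hinj⟩, hiso⟩, ?_⟩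
  refine Subtype.ext (LinearEquiv.ext fun x => ?_)
  induction x using Submodule.Quotient.induction_on with | _ v =>
  change redVec I (g₂ v) = k.1 (redVec I v)
  rw [← hg', Submodule.Quotient.eq, ← sub_add_sub_cancel _ (g₁ v)]
  exact Submodule.add_mem _ (Submodule.smul_mono_left Ideal.mul_le_left (h3 v)) (h1 v)

end Lifting

/-! ### The rings `R` and `A` -/

section RingFacts

variable {O : Type*} [CommRing O] (s : O) (l : ℕ)

theorem toA_eq_zero_of_mem (hl : 1 ≤ l) {x : QuadraticAlgebra O s 0} (h1 : toR s l x.re = 0)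
    (h2 : s ^ (l - 1) ∣ x.im) : toA s l x = 0 := by
  rw [toR_eq_zero_iff, Ideal.mem_span_singleton] at h1
  obtain ⟨c, hc⟩ := h1
  obtain ⟨d, hd⟩ := h2
  rw [toA_eq_zero_iff, Ideal.mem_span_singleton]
  obtain ⟨k, rfl⟩ : ∃ k, l = k + 1 := ⟨l - 1, by omega⟩
  refine ⟨⟨d, c⟩, ?_⟩
  rw [show 2 * (k + 1) - 1 = 2 * k + 1 by omega, omega_pow_odd]
  ext
  · simp [hc, pow_succ]; ring
  · simpa using hd

theorem finite_ringA [Finite (RingR s l)] (hl : 1 ≤ l) : Finite (RingA s l) := by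
  choose r hr using toR_surjective s l
  refine Finite.of_surjective (fun q : RingR s l × RingR s l => toA s l ⟨r q.1, r q.2⟩) fun a => ?_
  obtain ⟨x, rfl⟩ := toA_surjective s l a
  refine ⟨(toR s l x.re, toR s l x.im), sub_eq_zero.1 ?_⟩
  rw [← map_sub]
  refine toA_eq_zero_of_mem s l hl (by simp [hr]) ?_
  have h1 : toR s l (r (toR s l x.im) - x.im) = 0 := by rw [map_sub, hr, sub_self]
  rw [toR_eq_zero_iff, Ideal.mem_span_singleton] at h1
  exact (pow_dvd_pow s (Nat.sub_le l 1)).trans h1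

theorem conj_conj (a : RingA s l) : conj s l (conj s l a) = a := by
  obtain ⟨x, rfl⟩ := toA_surjective s l a
  rw [conj_mk, conj_mk, star_star]

theorem reA_conj (a : RingA s l) : reA s l (conj s l a) = reA s l a := by
  obtain ⟨x, rfl⟩ := toA_surjective s l a
  rw [conj_mk, reA_mk, reA_mk]
  simp

theorem reA_pi_sq_mul (a : RingA s l) : reA s l (pi s l ^ 2 * a) = p s l * reA s l a := by
  obtain ⟨x, rfl⟩ := toA_surjective s l a
  rw [pi, ← map_pow, ← map_mul, reA_mk, reA_mk, p, ← map_mul]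
  congr 1
  simp [sq]

theorem pi_pow_eq_zero {k : ℕ} (hk : 2 * l - 1 ≤ k) : pi s l ^ k = 0 := by
  rw [pi, ← map_pow, toA_eq_zero_iff, Ideal.mem_span_singleton]
  exact pow_dvd_pow _ hk

theorem isUnit_two_ringR (h2 : IsUnit (2 : O)) : IsUnit (2 : RingR s l) := by
  have := h2.map (toR s l)
  rwa [map_ofNat] at this

theorem isUnit_two_ringA (h2 : IsUnit (2 : O)) : IsUnit (2 : RingA s l) := by
  have := (h2.map (algebraMap O (QuadraticAlgebra O s 0))).map (toA s l)
  rwa [map_ofNat, map_ofNat] at this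

variable {s l}

theorem eq_zero_of_isPrimitive {R : Type*} [CommRing R] {lam : AddChar R ℂ} (hlam : lam.IsPrimitive)
    {a : R} (ha : ∀ r, lam (r * a) = 1) : a = 0 := by
  by_contra h0
  refine hlam h0 (DFunLike.ext _ _ fun r => ?_)
  rw [AddChar.mulShift_apply, mul_comm, ha]
  rfl

/-- Constants test the coordinate `re` modulo $s^l$, and multiples of $\pi$ test $s$ times the
coordinate `im`. The latter yields only $s^{l-1}\mid$ `im`, which is all that vanishing in $A$
requires. -/
theorem eq_zero_of_forall_reA [IsDomain O] (hs : s ≠ 0) (hl : 1 ≤ l)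
    {lam : AddChar (RingR s l) ℂ} (hlam : lam.IsPrimitive) {a : RingA s l}
    (ha : ∀ x, lam (reA s l (x * a)) = 1) : a = 0 := by
  obtain ⟨y, rfl⟩ := toA_surjective s l a
  have h1 : toR s l y.re = 0 := eq_zero_of_isPrimitive hlam fun r => by
    obtain ⟨c, rfl⟩ := toR_surjective s l r
    rw [← ha (toA s l ⟨c, 0⟩), ← map_mul, ← map_mul, reA_mk]
    simp
  have h2 : toR s l (s * y.im) = 0 := eq_zero_of_isPrimitive hlam fun r => by
    obtain ⟨c, rfl⟩ := toR_surjective s l r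
    rw [← ha (toA s l ⟨0, c⟩), ← map_mul, ← map_mul, reA_mk]
    congr 2
    simp
    ring
  refine toA_eq_zero_of_mem s l hl h1 ?_
  rw [toR_eq_zero_iff, Ideal.mem_span_singleton] at h2
  obtain ⟨k, rfl⟩ : ∃ k, l = k + 1 := ⟨l - 1, by omega⟩
  rw [pow_succ', mul_dvd_mul_iff_left hs] at h2
  simpa using h2

theorem exists_eq_pi_mul [IsDomain O] (hs : s ≠ 0) (hl : 1 ≤ l) {a : RingA s l}
    (ha : pi s l ^ (2 * l - 2) * a = 0) : ∃ c, a = pi s l * c := by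
  obtain ⟨y, rfl⟩ := toA_surjective s l a
  rw [pi, ← map_pow, ← map_mul, toA_eq_zero_iff, Ideal.mem_span_singleton] at ha
  obtain ⟨z, hz⟩ := ha
  -- Since $t$ is not a zero divisor before reduction, $t^{2l-2}y=t^{2l-1}z$ cancels to $y=tz$.
  have hreg : IsLeftRegular (ω : QuadraticAlgebra O s 0) := fun x x' hx => by
    have h1 := congrArg QuadraticAlgebra.re hx
    have h2 := congrArg QuadraticAlgebra.im hx
    simp [hs] at h1 h2
    ext
    · exact h2
    · exact h1
  refine ⟨toA s l z, ?_⟩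
  rw [pi, ← map_mul]
  congr 1
  refine hreg.pow (2 * l - 2) ?_
  change _ * _ = _ * _
  rw [hz, ← mul_assoc, ← pow_succ]
  congr 2
  omega

theorem lamBar_isPrimitive [IsDomain O] (hs : s ≠ 0) (hl : 1 ≤ l) {lam : AddChar (RingR s l) ℂ}
    (hlam : lam.IsPrimitive) : (lamBar s l lam).IsPrimitive := by
  intro a ha h1
  refine ha ?_
  obtain ⟨r, rfl⟩ := Ideal.Quotient.mk_surjective a
  obtain ⟨c, rfl⟩ := toR_surjective s l r
  have h2 : p s l * toR s l c = 0 := eq_zero_of_isPrimitive hlam fun r => by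
    have h3 := DFunLike.congr_fun h1 (Ideal.Quotient.mk _ (-r))
    rw [AddChar.mulShift_apply, ← map_mul, lamBar, AddChar.compAddMonoidHom_apply, negMulP_mk] at h3
    rw [← show lam _ = 1 from h3]
    congr 1
    ring
  rw [p, ← map_mul, toR_eq_zero_iff, Ideal.mem_span_singleton] at h2
  rw [Ideal.Quotient.eq_zero_iff_mem, idealM, Ideal.span_singleton_pow, Ideal.mem_span_singleton, p,
    ← map_pow]
  obtain ⟨k, rfl⟩ : ∃ k, l = k + 1 := ⟨l - 1, by omega⟩
  rw [pow_succ', mul_dvd_mul_iff_left hs] at h2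
  exact map_dvd _ h2

variable {V : Type*} [AddCommGroup V] [Module (RingA s l) V]

theorem mem_idealR_pow_smul_top {k : ℕ} {v : V} :
    v ∈ idealR s l ^ k • (⊤ : Submodule (RingA s l) V) ↔ ∃ w, v = pi s l ^ k • w := by
  rw [idealR, Ideal.span_singleton_pow, Submodule.ideal_span_singleton_smul,
    Submodule.mem_smul_pointwise_iff_exists]
  simp [eq_comm]

theorem exists_eq_pi_smul [IsDomain O] (hs : s ≠ 0) (hl : 1 ≤ l) [Module.Free (RingA s l) V]
    [Module.Finite (RingA s l) V] {v : V} (hv : pi s l ^ (2 * l - 2) • v = 0) :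
    ∃ w, v = pi s l • w := by
  let b := Module.Free.chooseBasis (RingA s l) V
  choose c hc using fun i => exists_eq_pi_mul hs hl (a := b.repr v i) (by
    rw [← smul_eq_mul, ← Finsupp.smul_apply, ← map_smul, hv, map_zero, Finsupp.zero_apply])
  refine ⟨∑ i, c i • b i, ?_⟩
  rw [Finset.smul_sum, ← b.sum_repr v]
  refine Finset.sum_congr rfl fun i _ => ?_
  rw [smul_smul, ← hc]

variable {h : V →ₛₗ[conj s l] V →ₗ[RingA s l] RingA s l}

theorem form_smul_left (a : RingA s l) (u v : V) : h (a • u) v = conj s l a * h u v := by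
  rw [map_smulₛₗ, LinearMap.smul_apply, smul_eq_mul]

theorem form_smul_right (a : RingA s l) (u v : V) : h u (a • v) = a * h u v := by
  rw [map_smul, smul_eq_mul]

theorem altForm_apply (u v : V) : altForm h u v = reA s l (h u v) := rfl

/-- The sign comes from $\pi^*\pi=-p$; it is the reason for the minus sign in $\bar\lambda$. -/
theorem altForm_pi_pi (u v : V) :
    altForm h (pi s l • u) (pi s l • v) = -(p s l * altForm h u v) := by
  rw [altForm_apply, altForm_apply, form_smul_left, form_smul_right, conj_pi, ← reA_pi_sq_mul,
    ← map_neg]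
  congr 1
  ring

theorem altForm_pi_pow (k : ℕ) (u v : V) :
    altForm h (pi s l ^ (2 * k) • u) v = altForm h u (pi s l ^ (2 * k) • v) := by
  rw [altForm_apply, altForm_apply, form_smul_left, form_smul_right, map_pow, conj_pi,
    (even_two_mul k).neg_pow]

/-- Even powers of $\pi$ are self-adjoint, so the factor moves across and produces $\pi^{2l-1}=0$.
Hence $\mathfrak rV$ is orthogonal to $\mathfrak nV$. -/
theorem altForm_pi_pow_pi (hl : 1 ≤ l) (u v : V) :
    altForm h (pi s l ^ (2 * l - 2) • u) (pi s l • v) = 0 := by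
  rw [show 2 * l - 2 = 2 * (l - 1) by omega, altForm_pi_pow, smul_smul, ← pow_succ,
    pi_pow_eq_zero s l (by omega), zero_smul, map_zero]

theorem altForm_self (h2 : IsUnit (2 : O)) (hh : IsNondegSkewHermitian h) (v : V) :
    altForm h v v = 0 := by
  have h1 : altForm h v v = -altForm h v v := by
    conv_lhs => rw [altForm_apply, hh.skew, map_neg, reA_conj]
    rfl
  refine (isUnit_two_ringR s l h2).mul_right_eq_zero.1 ?_
  rw [two_mul]
  nth_rewrite 1 [h1]
  rw [neg_add_cancel]

theorem eq_zero_of_altForm [IsDomain O] (hs : s ≠ 0) (hl : 1 ≤ l)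
    (hh : IsNondegSkewHermitian h) {lam : AddChar (RingR s l) ℂ} (hlam : lam.IsPrimitive) {v : V}
    (hv : ∀ u, lam (altForm h u v) = 1) : v = 0 := by
  refine hh.nondeg (LinearMap.ext fun u => ?_)
  have h1 : h u v = 0 := eq_zero_of_forall_reA hs hl hlam fun x => by
    rw [← hv (conj s l x • u), altForm_apply, form_smul_left, conj_conj]
  rw [hh.skew u v, h1]
  simp

theorem isRegular [IsDomain O] (hs : s ≠ 0) (hl : 1 ≤ l) (h2 : IsUnit (2 : O))
    (hh : IsNondegSkewHermitian h) {lam : AddChar (RingR s l) ℂ} {X : Type*} [AddCommGroup X]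
    [Module ℂ X] {S : Representation ℂ (Heis (altForm h)) X} (hS : IsSchrodinger lam S) :
    IsRegular lam S where
  central := hS.central
  irreducible := hS.irreducible
  alt := altForm_self h2 hh
  half v := by
    obtain ⟨c, hc⟩ := (isUnit_two_ringA s l h2).exists_right_inv
    exact ⟨c • v, by rw [← add_smul, ← two_mul, hc, one_smul]⟩
  nondeg _ := eq_zero_of_altForm hs hl hh hS.primitive

end RingFacts

/-! ### The action on `Bot` -/

section BotAction

variable {O : Type*} [CommRing O] {s : O} {l : ℕ} {V : Type*} [AddCommGroup V]
  [Module (RingA s l) V] {h : V →ₛₗ[conj s l] V →ₗ[RingA s l] RingA s l}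
  {X : Type*} [AddCommGroup X] [Module ℂ X] {S : Representation ℂ (Heis (altForm h)) X}
  {lam : AddChar (RingR s l) ℂ}

variable (s l V) in
/-- `nV = r^(2l-2)V` as an additive subgroup of `V`. -/
def minSub : AddSubgroup V :=
  (idealR s l ^ (2 * l - 2) • (⊤ : Submodule (RingA s l) V)).toAddSubgroup

theorem mem_minSub {v : V} : v ∈ minSub s l V ↔ ∃ w, v = pi s l ^ (2 * l - 2) • w :=
  mem_idealR_pow_smul_top

theorem Bot_eq (S : Representation ℂ (Heis (altForm h)) X) :
    Bot S = fixedPts S (minSub s l V : Set V) := rfl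

theorem trans_apply_of_mem_Bot {x : X} (hx : x ∈ Bot S) {w : V} (hw : w ∈ minSub s l V) :
    trans S w x = x := hx w hw

theorem altForm_minSub_pi (hl : 1 ≤ l) {w : V} (hw : w ∈ minSub s l V) (v : V) :
    altForm h w (pi s l • v) = 0 := by
  obtain ⟨u, rfl⟩ := mem_minSub.1 hw
  exact altForm_pi_pow_pi hl u v

theorem exists_eq_pi_smul_of_mem_minSub (hl : 1 < l) {w : V} (hw : w ∈ minSub s l V) :
    ∃ v, w = pi s l • v := by
  obtain ⟨u, rfl⟩ := mem_minSub.1 hw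
  exact ⟨pi s l ^ (2 * l - 3) • u, by rw [smul_smul, ← pow_succ']; congr 2; omega⟩

theorem minSub_isotropic (hl : 1 < l) {w : V} (hw : w ∈ minSub s l V) {w' : V}
    (hw' : w' ∈ minSub s l V) : altForm h w w' = 0 := by
  obtain ⟨v, rfl⟩ := exists_eq_pi_smul_of_mem_minSub hl hw'
  exact altForm_minSub_pi hl.le hw v

theorem map_mem_minSub (g : V →ₗ[RingA s l] V) {w : V} (hw : w ∈ minSub s l V) :
    g w ∈ minSub s l V := by
  obtain ⟨u, rfl⟩ := mem_minSub.1 hw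
  exact mem_minSub.2 ⟨g u, map_smul g _ _⟩

theorem pi_smul_mem_minSub (hl : 1 < l) {v : V}
    (hv : v ∈ idealJ s l • (⊤ : Submodule (RingA s l) V)) : pi s l • v ∈ minSub s l V := by
  rw [idealJ, mem_idealR_pow_smul_top] at hv
  obtain ⟨w, rfl⟩ := hv
  exact mem_minSub.2 ⟨w, by rw [smul_smul, ← pow_succ']; congr 2; omega⟩

section

variable (hS : IsRegular lam S)
include hS

theorem trans_pi_mem_Bot (hl : 1 ≤ l) (v : V) {x : X} (hx : x ∈ Bot S) :
    trans S (pi s l • v) x ∈ Bot S := by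
  intro w hw
  change trans S w _ = _
  rw [← Module.End.mul_apply, hS.trans_comm, altForm_minSub_pi hl hw, add_zero,
    AddChar.map_zero_eq_one, one_smul, Module.End.mul_apply, trans_apply_of_mem_Bot hx hw]

theorem apply_pi_mem_Bot (hl : 1 ≤ l) (r : RingR s l) (v : V) {x : X} (hx : x ∈ Bot S) :
    S ⟨r, pi s l • v⟩ x ∈ Bot S := by
  rw [hS.apply_eq]
  exact (Bot S).smul_mem _ (trans_pi_mem_Bot hS hl v hx)

theorem trans_add_apply_of_mem_Bot (hl : 1 ≤ l) (v : V) {w : V} (hw : w ∈ minSub s l V) {x : X}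
    (hx : x ∈ Bot S) : trans S (pi s l • v + w) x = trans S (pi s l • v) x := by
  have h1 := congrArg (fun B : Module.End ℂ X => B x) (hS.trans_mul (pi s l • v) w)
  rw [hS.skew, altForm_minSub_pi hl hw, neg_zero, AddChar.map_zero_eq_one, one_smul] at h1
  rw [← h1]
  change _ = trans S (pi s l • v) x
  rw [Module.End.mul_apply, trans_apply_of_mem_Bot hx hw]

/-- The Schrödinger representation of the reduced Heisenberg group afforded by `Bot`. -/
theorem exists_Sbar (hl : 1 < l) :
    ∃ Sbar : Representation ℂ (Heis (altFormBar h)) (Bot S),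
      ∀ (z : RingRbar s l) (v : V) (x : Bot S),
        (Sbar ⟨z, redVec _ v⟩ x : X) = S ⟨negMulP s l z, pi s l • v⟩ (x : X) := by
  -- The chosen lift of `k.v` is immaterial: two lifts differ by an element of $\mathfrak
  -- r^{2l-3}V$, which $\pi$ carries into $\mathfrak nV$, and this acts trivially on Bot.
  let T (k : Heis (altFormBar h)) : Module.End ℂ (Bot S) :=
    (S ⟨negMulP s l k.z, pi s l • Quotient.out k.v⟩).restrict
      fun x hx => apply_pi_mem_Bot hS hl.le _ _ hx
  have hT : ∀ (z : RingRbar s l) (v : V) (x : Bot S),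
      (T ⟨z, redVec _ v⟩ x : X) = S ⟨negMulP s l z, pi s l • v⟩ (x : X) := by
    intro z v x
    change S ⟨negMulP s l z, pi s l • Quotient.out (redVec (idealJ s l) v)⟩ (x : X) = _
    set v' := Quotient.out (redVec (idealJ s l) v) with hv'
    have h1 : redVec (idealJ s l) v' = redVec (idealJ s l) v := Quotient.out_eq _
    have h2 := pi_smul_mem_minSub hl ((Submodule.Quotient.eq _).1 h1)
    rw [hS.apply_eq, hS.apply_eq, LinearMap.smul_apply, LinearMap.smul_apply,
      ← trans_add_apply_of_mem_Bot hS hl.le v h2 x.2, smul_sub, add_sub_cancel]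
  refine ⟨⟨⟨T, ?_⟩, ?_⟩, hT⟩
  · ext x
    rw [Heis.one_def]
    change (T ⟨0, redVec _ 0⟩ x : X) = x
    rw [hT, map_zero, smul_zero]
    exact congrArg (fun B : Module.End ℂ X => B (x : X)) (map_one S)
  · rintro ⟨z, v⟩ ⟨z', v'⟩
    induction v using Submodule.Quotient.induction_on with | _ v =>
    induction v' using Submodule.Quotient.induction_on with | _ v' =>
    ext x
    change (T ⟨z + z' + altFormBar h (redVec _ v) (redVec _ v'), redVec _ (v + v')⟩ x : X) =
      (T ⟨z, redVec _ v⟩ (T ⟨z', redVec _ v'⟩ x) : X)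
    rw [hT, hT, hT, ← Module.End.mul_apply, ← map_mul, Heis.mul_def, altForm_pi_pi,
      altFormBar_mk, map_add, map_add, negMulP_mk, smul_add]

variable [FiniteDimensional ℂ X]

/-- The projection onto Bot, multiplied by parity, has trace $1$. -/
theorem Bot_ne_bot [Finite V] (hl : 1 < l) : Bot S ≠ ⊥ := by
  have := Fintype.ofFinite V
  have := Fintype.ofFinite (minSub s l V)
  intro h0
  have h1 : isotypicProj S (minSub s l V) 0 = 0 := by
    ext x
    have := hS.range_isotypicProj_zero (fun w hw w' hw' => minSub_isotropic hl hw hw') x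
    rw [← Bot_eq, h0] at this
    exact this
  have h2 := hS.trace_isotypicProj_mul_parity (N := minSub s l V)
  rw [h1, zero_mul, map_zero] at h2
  exact zero_ne_one h2

/-- A nonzero subspace of `Bot` stable under `(0,rV)` is the whole of `Bot`. -/
theorem Bot_le_of_stable [IsDomain O] (hs : s ≠ 0) (h2 : IsUnit (2 : O)) [Finite V]
    [Module.Free (RingA s l) V] [Module.Finite (RingA s l) V] (hh : IsNondegSkewHermitian h)
    (hlam : lam.IsPrimitive) (hl : 1 < l) {Z : Submodule ℂ X}
    (hZ0 : Z ≠ ⊥) (hZ : Z ≤ Bot S) (hst : ∀ v, ∀ z ∈ Z, trans S (pi s l • v) z ∈ Z) :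
    Bot S ≤ Z := by
  have := Fintype.ofFinite V
  have := Fintype.ofFinite (minSub s l V)
  refine hS.fixedPts_le_of_stable (N := minSub s l V) hZ0 hZ fun u hu z hz => ?_
  obtain ⟨c, hc⟩ := (isUnit_two_ringA s l h2).exists_right_inv
  -- Orthogonality of `u` to $\mathfrak nV$ moves $\pi^{2l-2}$ onto `u`, and the annihilator of
  -- $\pi^{2l-2}$ in $V$ is $\pi V$. The factor `c` is $\tfrac12$ and undoes the doubling in `hu`.
  have h3 : pi s l ^ (2 * l - 2) • u = 0 := eq_zero_of_altForm hs hl.le hh hlam fun v => by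
    have h4 := hu (pi s l ^ (2 * l - 2) • c • v) (mem_minSub.2 ⟨_, rfl⟩)
    rw [← AddMonoidHom.add_apply, ← map_add, ← smul_add, ← add_smul, ← two_mul, hc, one_smul,
      show 2 * l - 2 = 2 * (l - 1) by omega, altForm_pi_pow] at h4
    rwa [show 2 * l - 2 = 2 * (l - 1) by omega]
  obtain ⟨v, rfl⟩ := exists_eq_pi_smul hs hl.le h3
  exact hst v z hz

end

end BotAction

/-! ### The action of the unitary group, and of its subgroup $\Omega$, on Bot. -/

section WeilAction

variable {O : Type*} [CommRing O] {s : O} {l : ℕ} {V : Type*} [AddCommGroup V]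
  [Module (RingA s l) V]
  {h : V →ₛₗ[conj s l] V →ₗ[RingA s l] RingA s l}
  {X : Type*} [AddCommGroup X] [Module ℂ X] {S : Representation ℂ (Heis (altForm h)) X}
  {lam : AddChar (RingR s l) ℂ} (hS : IsRegular lam S)
  {W : Representation ℂ (unitaryGroup h) X}
  (hW : ∀ (g : unitaryGroup h) (v : V), W g * trans S v = trans S (g.1 v) * W g)

include hS hW in
theorem isWeil_of_comm : IsWeil S W := by
  intro g r u
  change W g * (S ⟨r, u⟩ * W g⁻¹) = S ⟨r, g.1 u⟩
  rw [hS.apply_eq, hS.apply_eq, smul_mul_assoc, mul_smul_comm, ← mul_assoc, hW, mul_assoc,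
    ← map_mul, mul_inv_cancel, map_one, mul_one]

include hW in
theorem apply_mem_Bot (g : unitaryGroup h) {x : X} (hx : x ∈ Bot S) : W g x ∈ Bot S := by
  intro w hw
  change trans S w (W g x) = W g x
  have h1 : g.1 (g.1.symm w) = w := g.1.apply_symm_apply w
  have h2 := congrArg (fun B : Module.End ℂ X => B x) (hW g (g.1.symm w))
  rw [h1] at h2
  change W g (trans S _ x) = trans S w (W g x) at h2
  have h3 : g.1.symm w ∈ minSub s l V := map_mem_minSub g.1.symm.toLinearMap hw
  rw [← h2, trans_apply_of_mem_Bot hx h3]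

include hS hW in
-- On Bot, $T_{g(\pi v)}=T_{\pi v}$ because $g$ moves $\pi v$ by an element of $\mathfrak nV$. An
-- eigenspace of $W(g)$ inside Bot is therefore stable under $\mathfrak rV$, hence all of Bot.
theorem apply_eq_smul_of_mem_Omega [IsDomain O] [Module.Free (RingA s l) V]
    [Module.Finite (RingA s l) V] [FiniteDimensional ℂ X] [Finite V] (hs : s ≠ 0)
    (h2 : IsUnit (2 : O)) (hh : IsNondegSkewHermitian h) (hlam : lam.IsPrimitive) (hl : 1 < l)
    {g : unitaryGroup h} (hg : g ∈ Omega h) : ∃ c : ℂ, ∀ x ∈ Bot S, W g x = c • x := by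
  have : Nontrivial (Bot S) := Submodule.nontrivial_iff_ne_bot.2 (Bot_ne_bot hS hl)
  obtain ⟨c, hc⟩ := Module.End.exists_eigenvalue
    ((W g).restrict fun x (hx : x ∈ Bot S) => apply_mem_Bot hW g hx)
  obtain ⟨x, hx⟩ := hc.exists_hasEigenvector
  refine ⟨c, fun y hy => ?_⟩
  have h3 : Bot S ≤ Module.End.eigenspace (W g) c ⊓ Bot S := by
    refine Bot_le_of_stable hS hs h2 hh hlam hl ?_ inf_le_right fun v z hz => ?_
    · refine (Submodule.ne_bot_iff _).2 ⟨x, ⟨?_, x.2⟩, fun h0 => hx.2 (Subtype.ext h0)⟩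
      exact Module.End.mem_eigenspace_iff.2 (congrArg Subtype.val hx.apply_eq_smul)
    · refine ⟨?_, trans_pi_mem_Bot hS hl.le v hz.2⟩
      have hz1 := Module.End.mem_eigenspace_iff.1 hz.1
      refine Module.End.mem_eigenspace_iff.2 ?_
      have h4 := pi_smul_mem_minSub hl ((mem_Omega h g).1 hg v)
      have h5 : g.1 (pi s l • v) = pi s l • v + pi s l • (g.1 v - v) := by
        rw [map_smul, smul_sub, add_sub_cancel]
      rw [← Module.End.mul_apply, hW, Module.End.mul_apply, hz1, map_smul, h5,
        trans_add_apply_of_mem_Bot hS hl.le v h4 hz.2]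
  exact Module.End.mem_eigenspace_iff.1 (h3 hy).1

theorem Omega_fix_minSub (hl : 1 < l) {g : unitaryGroup h} (hg : g ∈ Omega h) {w : V}
    (hw : w ∈ minSub s l V) : g.1 w = w := by
  obtain ⟨u, rfl⟩ := mem_minSub.1 hw
  have h1 := (mem_Omega h g).1 hg u
  rw [idealJ, mem_idealR_pow_smul_top] at h1
  obtain ⟨v, hv⟩ := h1
  rw [map_smul, ← sub_eq_zero, ← smul_sub, hv, smul_smul, ← pow_add,
    pi_pow_eq_zero s l (by omega), zero_smul]

end WeilAction

end RamWeil

end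

theorem mainTheorem6 {O : Type*} [CommRing O] [IsDomain O] [IsDiscreteValuationRing O]
    [Finite (IsLocalRing.ResidueField O)] (hodd : ringChar (IsLocalRing.ResidueField O) ≠ 2)
    (s : O) (hs : IsLocalRing.maximalIdeal O = Ideal.span {s})
    (l : ℕ) (hl : 1 < l)
    {V : Type*} [AddCommGroup V] [Module (RamWeil.RingA s l) V]
    [Module.Free (RamWeil.RingA s l) V] [Module.Finite (RamWeil.RingA s l) V] [Nontrivial V]
    (h : V →ₛₗ[RamWeil.conj s l] V →ₗ[RamWeil.RingA s l] RamWeil.RingA s l)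
    (hh : RamWeil.IsNondegSkewHermitian h)
    (lam : AddChar (RamWeil.RingR s l) ℂ)
    {X : Type*} [AddCommGroup X] [Module ℂ X] [FiniteDimensional ℂ X]
    (S : Representation ℂ (RamWeil.Heis (RamWeil.altForm h)) X)
    (hS : RamWeil.IsSchrodinger lam S) :
    ∃ W : Representation ℂ (RamWeil.unitaryGroup h) X,
      RamWeil.IsWeil S W ∧
      (∀ g ∈ RamWeil.Omega h, ∀ x ∈ RamWeil.Bot S, W g x = x) ∧
      ∃ Wbar : Representation ℂ (RamWeil.unitaryGroup (RamWeil.hbar h)) (RamWeil.Bot S),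
        RamWeil.IsAffordedByBot S W Wbar ∧
        (∀ W' : Representation ℂ (RamWeil.unitaryGroup (RamWeil.hbar h)) (RamWeil.Bot S),
          RamWeil.IsAffordedByBot S W W' → W' = Wbar) ∧
        ∃ Sbar : Representation ℂ (RamWeil.Heis (RamWeil.altFormBar h)) (RamWeil.Bot S),
          RamWeil.IsSchrodinger (RamWeil.lamBar s l lam) Sbar ∧
          (∀ (r : RamWeil.RingR s l) (v : V) (x : RamWeil.Bot S),
            (Sbar ⟨-Ideal.Quotient.mk _ r, RamWeil.redVec _ v⟩ x : X) =
              S ⟨RamWeil.p s l * r, RamWeil.pi s l • v⟩ (x : X)) ∧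
          RamWeil.IsWeil Sbar Wbar := by
  open RamWeil in
  have hs0 : s ≠ 0 := by
    rintro rfl
    exact IsDiscreteValuationRing.not_a_field O (by rw [hs, Ideal.span_singleton_eq_bot])
  have h2 : IsUnit (2 : O) := by
    rw [← IsLocalRing.residue_ne_zero_iff_isUnit, map_ofNat]
    exact Ring.two_ne_zero hodd
  have : Finite (RingR s l) := by
    have h1 : Finite (O ⧸ IsLocalRing.maximalIdeal O) :=
      inferInstanceAs (Finite (IsLocalRing.ResidueField O))
    have h3 := Ideal.finite_quotient_pow (I := IsLocalRing.maximalIdeal O)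
      ⟨{s}, by rw [hs, Finset.coe_singleton]⟩ l
    rwa [hs, Ideal.span_singleton_pow] at h3
  have : Finite (RingA s l) := finite_ringA s l hl.le
  have : Finite V := Module.finite_of_finite (RingA s l)
  have := Fintype.ofFinite V
  have := Fintype.ofFinite (minSub s l V)
  have hreg := isRegular hs0 hl.le h2 hh hS
  obtain ⟨W, hWc⟩ := hreg.exists_canonicalRep
    (fun g : unitaryGroup h => g.1.toAddEquiv) (fun _ => rfl) (fun _ _ _ => rfl)
    (fun g u v => congrArg (reA s l) (g.2 u v))
  have hW : ∀ (g : unitaryGroup h) (v : V), W g * trans S v = trans S (g.1 v) * W g :=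
    fun g v => (hWc g).comm v
  have hΩ : ∀ g ∈ Omega h, ∀ x ∈ Bot S, W g x = x := by
    intro g hg x hx
    obtain ⟨c, hc⟩ := apply_eq_smul_of_mem_Omega hreg hW hs0 h2 hh hS.primitive hl hg
    have hc1 := hreg.eq_one_of_isCanonical (fun w hw w' hw' => minSub_isotropic hl hw hw')
      g.1.bijective (fun w hw => Omega_fix_minSub hl hg hw) (hWc g) hc
    rw [hc x hx, hc1, one_smul]
  have hsurj : Function.Surjective (toUbar h) := by
    refine redU_surjective hh (conj_conj s l) (isUnit_two_ringA s l h2) (idealJ_le s l) ?_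
    -- The fourth power suffices because $4(2l-3)\ge 2l-1$ for $l\ge2$; when $l=2$ the square alone
    -- would not be zero.
    rw [idealJ, ← pow_add, ← pow_add, idealR, Ideal.span_singleton_pow,
      pi_pow_eq_zero s l (by omega), Ideal.span_singleton_zero]
  let WB : Representation ℂ (unitaryGroup h) (Bot S) :=
    { toFun := fun g => (W g).restrict fun x hx => apply_mem_Bot hW g hx
      map_one' := by ext x; simp
      map_mul' := fun g g' => by ext x; simp }
  obtain ⟨Wbar, hWbar⟩ : ∃ Wbar : Representation ℂ (unitaryGroup (hbar h)) (Bot S),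
      ∀ g, Wbar (toUbar h g) = WB g := by
    choose r hr using hsurj
    -- Two lifts differ by an element of $\Omega$, which acts trivially on Bot, so the action
    -- descends along any section.
    have key : ∀ g g', toUbar h g = toUbar h g' → WB g = WB g' := fun g g' hgg => by
      have h3 : g'⁻¹ * g ∈ Omega h := by
        rw [Omega, MonoidHom.mem_ker, map_mul, map_inv, hgg, inv_mul_cancel]
      have h4 : WB (g'⁻¹ * g) = 1 := by
        ext x
        exact hΩ _ h3 x x.2
      rw [← mul_one (WB g'), ← h4, ← map_mul, mul_inv_cancel_left]
    refine ⟨{ toFun := fun k => WB (r k), map_one' := ?_, map_mul' := fun k k' => ?_ },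
      fun g => key _ _ (hr _)⟩
    · rw [key (r 1) 1 (by rw [hr, map_one]), map_one]
    · rw [key (r (k * k')) (r k * r k') (by rw [hr, map_mul, hr, hr]), map_mul]
  obtain ⟨Sbar, hSbar⟩ := exists_Sbar hreg hl
  have hlB := lamBar_isPrimitive hs0 hl.le hS.primitive
  refine ⟨W, isWeil_of_comm hreg hW, hΩ, Wbar, fun g x => ?_, fun W' hW' => ?_, Sbar,
    ⟨hlB, ?_, fun z x => ?_⟩, fun r v x => ?_, fun k z v => ?_⟩
  · rw [hWbar]; rfl
  · ext k x
    obtain ⟨g, rfl⟩ := hsurj k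
    rw [← hW', hWbar]; rfl
  · have hne := Bot_ne_bot hreg hl
    have : Nontrivial (Subrepresentation Sbar) := ⟨⊥, ⊤, fun h0 => hne (by
      have h1 := congrArg Subrepresentation.toSubmodule h0
      have h3 : (⊥ : Submodule ℂ (Bot S)) = ⊤ := h1
      have h4 := congrArg (Submodule.map (Bot S).subtype) h3
      rw [Submodule.map_bot, Submodule.map_subtype_top] at h4
      exact h4.symm)⟩
    refine ⟨fun Z => ?_⟩
    by_cases hZ : Z.toSubmodule = ⊥
    · exact Or.inl (Subrepresentation.toSubmodule_injective hZ)
    refine Or.inr (Subrepresentation.toSubmodule_injective ?_)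
    -- Irreducibility of `Sbar` is inherited from that of Bot under $\mathfrak rV$: the image of `Z`
    -- in $X$ is stable because $(0,\bar v)$ acts as $T_{\pi v}$.
    have h3 : Bot S ≤ Z.toSubmodule.map (Bot S).subtype := by
      refine Bot_le_of_stable hreg hs0 h2 hh hS.primitive hl ?_ (Submodule.map_subtype_le _ _) ?_
      · exact fun h0 => hZ (Submodule.map_injective_of_injective (Bot S).injective_subtype
          (h0.trans (Submodule.map_bot _).symm))
      · rintro v _ ⟨z, hz, rfl⟩
        refine ⟨Sbar ⟨0, redVec _ v⟩ z, Z.apply_mem_toSubmodule _ hz, ?_⟩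
        rw [Submodule.subtype_apply, hSbar, map_zero]
        rfl
    refine eq_top_iff.2 fun x _ => ?_
    obtain ⟨z, hz, hzx⟩ := h3 x.2
    rwa [← Subtype.ext hzx]
  · refine Subtype.ext ?_
    change (Sbar ⟨z, redVec _ 0⟩ x : X) = _
    rw [hSbar, smul_zero, hS.central]
    rfl
  · rw [hSbar, map_neg, negMulP_mk, neg_neg]
  · obtain ⟨g, rfl⟩ := hsurj k
    induction v using Submodule.Quotient.induction_on with | _ v =>
    ext x
    change (Wbar (toUbar h g) (Sbar ⟨z, redVec _ v⟩ (Wbar (toUbar h g)⁻¹ x)) : X) =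
      (Sbar ⟨z, redVec _ (g.1 v)⟩ x : X)
    have h3 : ∀ (g : unitaryGroup h) (y : Bot S), (Wbar (toUbar h g) y : X) = W g y :=
      fun g y => by rw [hWbar]; rfl
    rw [h3, hSbar, ← map_inv, h3, hSbar, ← map_smul g.1, ← isWeil_of_comm hreg hW]
    rfl
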